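/- Let $\mathbb F_q$ be a finite field of odd characteristic and let $C: y^2=f(x)$, with $f\in\mathbb F_q[x]$ monic, squarefree and of degree $5$, be a hyperelliptic curve of genus $2$ with point at infinity $\mathcal O$. Let $w(x,y)=(x,-y)$ be the hyperelliptic involution and $\varphi(x,y)=(x^q,y^q)$ the Frobenius map, both fixing $\mathcal O$ and extended linearly to divisors on $C$ over $\overline{\mathbb F}_q$. A divisor is $\mathbb F_{q^n}$-rational, $D\in\mathrm{Div}(\mathbb F_{q^n})$, if $\varphi^n(D)=D$; $\mathrm{Pic}(\mathbb F_{q^n})$ is the group of classes, modulo principal divisors, of $\mathbb F_{q^n}$-rational divisors of degree zero, and $$T_3=\{[D]\in \mathrm{Pic}(\mathbb F_{q^3}) : \mathrm{Tr}(D):=D+\varphi(D)+\varphi^2(D)\sim 0\}.$$ A divisor $P_1+\dots+P_r-r\mathcal O$ with $P_i\neq\mathcal O$ is semi-reduced if $P_i\ne w(P_j)$ for all $i\neq j$, and reduced if moreover $r\le 2$. The Mumford representation $[u,v]$ of a semi-reduced divisor $P_1+\dots+P_r-r\mathcal O$ with $P_i=(X_i,Y_i)$ is given by $u=\prod_i (x-X_i)$,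 $\deg v<\deg u$, $v(X_i)=Y_i$ for all $i$, and $u\mid v^2-f$. Assume that $2,3\nmid |\mathrm{Pic}(\mathbb F_{q^3})|$. Then every non-zero class in $T_3$ is represented by a reduced divisor, and every reduced divisor $D$ representing it is of the form $D=P_1+P_2-2\mathcal O$ with $P_1,P_2\neq\mathcal O$ and $D\notin\mathrm{Div}(\mathbb F_q)$, where exactly one of the following holds: (i) $P_1,P_2\in C(\mathbb F_{q^3})\setminus\{\mathcal O\}$ and $P_1\in\{w(\varphi(P_2)),w(\varphi^2(P_2))\}$; (ii) $P_1,P_2\in C(\mathbb F_{q^3})\setminus\{\mathcal O\}$ and $P_1\neq P_2,\varphi(P_2),\varphi^2(P_2),w(\varphi(P_2)),w(\varphi^2(P_2))$; (iii) $P_1\in C(\mathbb F_{q^6})\setminus C(\mathbb F_{q^3})$ and $P_2=\varphi^3(P_1)$. Let $[u,v]$ be the Mumford representation of $D$. There is a function $h_D=h_{D,1}(x)+y\,h_{D,2}(x)$ with $h_{D,1},h_{D,2}\in\mathbb F_q[x]$ and $\mathrm{div}(h_D)=\mathrm{Tr}(D)$. In cases (ii) and (iii) the divisor $D+\varphi(D)$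 is semi-reduced, and for every such $h_D$ we have $u\nmid h_{D,2}$; in particular $h_{D,2}\neq 0$. -/

import Mathlib

open Polynomial

namespace OddHyperelliptic

section Curve

variable {F : Type*} [Field F] (f : F[X]) (K : Type*) [Field K] [Algebra F K]

/-- The `K`-points of the projective curve `y ^ 2 = f x` (with `f` of odd degree), that is, the
affine points with coordinates in `K` and the unique point `𝒪` at infinity. Below, `F` is a finite
field and `K` an algebraic closure of it, so these are all the geometric points. -/
inductive Point : Type _
  | infinity : Point
  | affine (x y : K) (h : y ^ 2 = aeval x f) : Point

/-- The group of divisors on the curve. -/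
abbrev Divisor := Point f K →₀ ℤ

/-- The affine coordinate ring `K[x][y] / (y ^ 2 - f x)`. -/
abbrev CoordRing := AdjoinRoot (X ^ 2 - C (f.map (algebraMap F K)) : K[X][X])

variable {f K}

/-- The polynomial function `a(x) + y b(x)` on the affine curve. -/
noncomputable def polyFun (a b : K[X]) : CoordRing f K :=
  AdjoinRoot.of _ a + AdjoinRoot.root _ * AdjoinRoot.of _ b

namespace Point

/-- The involution `(x, y) ↦ (x, -y)`, `𝒪 ↦ 𝒪`. -/
def w : Point f K → Point f K
  | infinity => infinity
  | affine x y h => affine x (-y) (by rw [neg_sq, h])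

/-- The `q`-Frobenius `(x, y) ↦ (x ^ q, y ^ q)`, `𝒪 ↦ 𝒪`, where `q` is the size of `F`. -/
def frob [Fintype F] : Point f K → Point f K
  | infinity => infinity
  | affine x y h => affine (x ^ Fintype.card F) (y ^ Fintype.card F) (by
      have e := aeval_algHom_apply (FiniteField.frobeniusAlgHom F K) x f
      simp only [FiniteField.coe_frobeniusAlgHom] at e
      rw [e, ← h, ← pow_mul, ← pow_mul, mul_comm])

/-- `P` is defined over the extension of degree `n` of the finite field `F`: both coordinates lie in
it, that is, `P` is fixed by the `n`-th power of the Frobenius map. -/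
def IsRational [Fintype F] (n : ℕ) (P : Point f K) : Prop := frob^[n] P = P

/-- The ideal `(x - x₀, y - y₀)` of the coordinate ring, for given `x₀`, `y₀`. -/
noncomputable def pointIdeal (x₀ y₀ : K) : Ideal (CoordRing f K) :=
  Ideal.span {AdjoinRoot.of _ (X - C x₀), AdjoinRoot.root _ - AdjoinRoot.of _ (C y₀)}

open Classical in
/-- The order at a point of a nonzero polynomial function `a(x) + y b(x)`. At an affine point it is
the largest `n` such that the function lies in the `n`-th power of the maximal ideal of the point.
At `𝒪` it is determined by the fact that `x` has a pole of order `2` and `y` a pole of order `deg f`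
there; the orders of `a(x)` and `y b(x)` have different parities, so the larger pole order is that
of the sum. -/
noncomputable def ord (a b : K[X]) : Point f K → ℤ
  | infinity =>
      -((max (2 * a.natDegree) (if b = 0 then 0 else f.natDegree + 2 * b.natDegree) : ℕ) : ℤ)
  | affine x y _ => ((sSup {n : ℕ | polyFun a b ∈ pointIdeal (f := f) x y ^ n} : ℕ) : ℤ)

end Point

/-- `D` is the divisor of the nonzero polynomial function `a(x) + y b(x)`. -/
def IsDivOf (a b : K[X]) (D : Divisor f K) : Prop :=
  (a ≠ 0 ∨ b ≠ 0) ∧ ∀ P : Point f K, D P = P.ord a b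

variable (f K)

/-- The group of principal divisors. Every rational function is a quotient of polynomial functions,
so it is generated by the divisors of the latter. -/
noncomputable def principal : AddSubgroup (Divisor f K) :=
  AddSubgroup.closure {D | ∃ a b : K[X], IsDivOf a b D}

/-- The divisors of degree zero. -/
noncomputable def degZero : AddSubgroup (Divisor f K) :=
  (Finsupp.liftAddHom (fun _ : Point f K => AddMonoidHom.id ℤ)).ker

/-- The group of all divisor classes; the classes of degree-zero divisors form the subgroup `Pic`
and only those occur below. -/
noncomputable abbrev ClassGroup := Divisor f K ⧸ principal f K

/-- The map that sends a divisor to its class. -/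
noncomputable abbrev toClass : Divisor f K →+ ClassGroup f K := QuotientAddGroup.mk' (principal f K)

section Frobenius

variable [Fintype F]

/-- The `n`-th power of the Frobenius map on divisors, induced by that on points. -/
noncomputable def frobPow (n : ℕ) : Divisor f K →+ Divisor f K :=
  Finsupp.mapDomain.addMonoidHom Point.frob^[n]

/-- The Frobenius map on divisors. -/
noncomputable def frobDiv : Divisor f K →+ Divisor f K :=
  Finsupp.mapDomain.addMonoidHom Point.frob

/-- The divisors of degree zero that are rational over the extension of degree `n` of `F`, that is,
fixed by the `n`-th power of the Frobenius map. -/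
noncomputable def ratDivZero (n : ℕ) : AddSubgroup (Divisor f K) :=
  degZero f K ⊓ (frobPow f K n).eqLocus (AddMonoidHom.id _)

/-- The trace `D ↦ D + φ D + ⋯ + φ ^ (n - 1) D`. -/
noncomputable def trace (n : ℕ) : Divisor f K →+ Divisor f K :=
  ∑ i ∈ Finset.range n, frobPow f K i

/-- `Pic(𝔽_{q^n})`: the classes of `𝔽_{q^n}`-rational divisors of degree zero. -/
noncomputable def picRat (n : ℕ) : AddSubgroup (ClassGroup f K) :=
  (ratDivZero f K n).map (toClass f K)

/-- The trace zero subgroup `T_n` of `Pic(𝔽_{q^n})`: the classes of those `𝔽_{q^n}`-rational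
divisors of degree zero whose trace is principal. -/
noncomputable def traceZero (n : ℕ) : AddSubgroup (ClassGroup f K) :=
  (ratDivZero f K n ⊓ (principal f K).comap (trace f K n)).map (toClass f K)

end Frobenius

variable {f K}

/-- `D = P₁ + ⋯ + P_r - r 𝒪` with affine points `P_i` such that `P_i ≠ w(P_j)` for `i ≠ j`. -/
def IsSemiReducedWith (r : ℕ) (D : Divisor f K) : Prop :=
  ∃ P : Fin r → Point f K, (∀ i, P i ≠ Point.infinity) ∧ (∀ i j, i ≠ j → P i ≠ (P j).w) ∧
    D = ∑ i, Finsupp.single (P i) 1 - Finsupp.single Point.infinity (r : ℤ)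

/-- Semi-reduced divisors. -/
def IsSemiReduced (D : Divisor f K) : Prop := ∃ r, IsSemiReducedWith r D

/-- Reduced divisors on a curve of genus `g`. -/
def IsReduced (g : ℕ) (D : Divisor f K) : Prop := ∃ r ≤ g, IsSemiReducedWith r D

/-- The divisor `P₁ + P₂ - 2𝒪`. -/
noncomputable def pairDiv (P₁ P₂ : Point f K) : Divisor f K :=
  Finsupp.single P₁ 1 + Finsupp.single P₂ 1 - Finsupp.single Point.infinity 2

/-- The factor `(x - x₀) ^ m` that an affine point `(x₀, y₀)` of multiplicity `m` contributes to the
`u`-polynomial of a divisor. -/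
noncomputable def uFactor : Point f K → ℤ → K[X]
  | .infinity, _ => 1
  | .affine x _ _, m => (X - C x) ^ m.toNat

/-- `[u, v]` is the Mumford representation of the semi-reduced divisor `D = P₁ + ⋯ + P_r - r 𝒪`,
`P_i = (x_i, y_i)`: `u = ∏ (x - x_i)`, `deg v < deg u`, `v(x_i) = y_i` for all `i` and
`u ∣ v ^ 2 - f`. The last condition makes `v(x_i) = y_i` hold with multiplicities. -/
structure IsMumford (D : Divisor f K) (u v : K[X]) : Prop where
  u_eq : u = D.prod uFactor
  degree_lt : v.degree < u.degree
  eval_eq : ∀ (x y : K) (h : y ^ 2 = aeval x f), D (.affine x y h) ≠ 0 → v.eval x = y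
  dvd : u ∣ v ^ 2 - f.map (algebraMap F K)

section Configurations

variable [Fintype F]

/-- The first configuration: both points are `𝔽_{q^3}`-rational affine points and `P₁` is `w(φ(P₂))`
or `w(φ²(P₂))`. -/
def ConfigI (P₁ P₂ : Point f K) : Prop :=
  P₁ ≠ .infinity ∧ P₂ ≠ .infinity ∧ P₁.IsRational 3 ∧ P₂.IsRational 3 ∧
    (P₁ = P₂.frob.w ∨ P₁ = P₂.frob.frob.w)

/-- The second configuration: both points are `𝔽_{q^3}`-rational affine points and `P₁` is none of
`P₂`, `φ(P₂)`, `φ²(P₂)`, `w(φ(P₂))`, `w(φ²(P₂))`. -/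
def ConfigII (P₁ P₂ : Point f K) : Prop :=
  P₁ ≠ .infinity ∧ P₂ ≠ .infinity ∧ P₁.IsRational 3 ∧ P₂.IsRational 3 ∧
    P₁ ≠ P₂ ∧ P₁ ≠ P₂.frob ∧ P₁ ≠ P₂.frob.frob ∧ P₁ ≠ P₂.frob.w ∧ P₁ ≠ P₂.frob.frob.w

/-- The third configuration: `P₁` is defined over `𝔽_{q^6}` but not over `𝔽_{q^3}`, and `P₂` is its
conjugate `φ³(P₁)`. -/
def ConfigIII (P₁ P₂ : Point f K) : Prop :=
  P₁.IsRational 6 ∧ ¬ P₁.IsRational 3 ∧ P₂ = P₁.frob.frob.frob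

end Configurations

end Curve

end OddHyperelliptic

namespace OddHyperelliptic

/-! Divisors are studied through explicit functions `a(x) + y b(x)` and their norms `a² - f b²`. The
maximal ideal of an affine point is locally generated by one element (`x - x₀`, or `y` at a
Weierstrass point), so affine orders are additive on products; at infinity the order is minus the
degree of the norm. Multiplying by conjugates then shows that a principal divisor with no affine
poles is the divisor of some `a + y b` (`exists_isDivOf`).

The decisive fact is a gap at infinity: if `b ≠ 0`, the pole order of `a + y b` is at least `deg f =
5`. A smaller pole order thus forces a polynomial in `x`, whose divisor is `w`-invariant, has even
order at infinity and even order at Weierstrass points. Hence reduced divisors are unique in their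
classes (`IsReduced.eq_of_toClass_eq`), and neither `P - 𝒪` nor its trace, with pole orders 1 and 3,
is principal. Existence of reduced divisors comes from intersecting the curve with `y = v(x)`, `deg
v ≤ 2`, which trades three points for two (`exists_add_eq_of_three`).

For a non-zero class in the trace zero subgroup, uniqueness makes a reduced representative
`φ³`-stable; weights 0 and 1 are impossible, so it is `P + Q - 2𝒪` with `φ³` fixing or exchanging
`P` and `Q`. If `P` were a conjugate of a rational `Q`, the trace would be twice that of `Q - 𝒪`,
contradicting the absence of 2-torsion; if `D` were `φ`-stable, the trace would be `3D`,
contradicting the absence of 3-torsion. The trace has pole order 6, so `h_D` has a cubic `a` and a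
constant `b`; normalizing `a` to be monic makes it descend to `F`. In cases (ii) and (iii) no two
points of the trace are opposite, so the trace is semi-reduced and is not the divisor of a
polynomial in `x`. Thus `b` is a non-zero constant, which the quadratic `u` cannot divide. -/

/-- The largest `n` such that `g` lies in the `n`-th power of the ideal `m`. -/
noncomputable def idealOrd {R : Type*} [CommRing R] (m : Ideal R) (g : R) : ℕ :=
  sSup {n : ℕ | g ∈ m ^ n}

/-- `t` generates the maximal ideal `m` locally at `m`. -/
structure IsUniformizer {R : Type*} [CommRing R] (m : Ideal R) (t : R) : Prop where
  mem : t ∈ m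
  ne_zero : t ≠ 0
  exists_mul : ∃ s ∉ m, ∀ g ∈ m, t ∣ s * g

/-! ### Orders at a locally principal maximal ideal of a Noetherian domain. -/

section IdealOrd

variable {R : Type*} [CommRing R] {m : Ideal R} [hm : m.IsMaximal] {t : R}

/-- Since `m` is maximal, `s` is a unit modulo every power of `m`; this replaces passing to the
localization. -/
theorem mem_pow_of_mul_mem_pow {s g : R} {n : ℕ} (hs : s ∉ m) (h : s * g ∈ m ^ n) :
    g ∈ m ^ n := by
  have hc : IsCoprime (Ideal.span {s}) (m ^ n) := by
    apply IsCoprime.pow_right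
    obtain ⟨y, i, hi, e⟩ := hm.exists_inv hs
    exact Ideal.isCoprime_iff_exists.2
      ⟨y * s, Ideal.mem_span_singleton'.2 ⟨y, rfl⟩, i, hi, e⟩
  rw [Ideal.isCoprime_iff_exists] at hc
  obtain ⟨a, ha, b, hb, hab⟩ := hc
  obtain ⟨c, rfl⟩ := Ideal.mem_span_singleton'.1 ha
  have : g = c * (s * g) + g * b := by linear_combination (-g) * hab
  rw [this]
  exact add_mem (Ideal.mul_mem_left _ _ h) (Ideal.mul_mem_left _ _ hb)

theorem IsUniformizer.exists_of_mem_pow (ht : IsUniformizer m t) {n : ℕ} :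
    ∃ s ∉ m, ∀ g ∈ m ^ n, t ^ n ∣ s * g := by
  obtain ⟨s, hs, h⟩ := ht.exists_mul
  refine ⟨s ^ n, fun h' => hs (hm.isPrime.mem_of_pow_mem n h'), ?_⟩
  induction n with
  | zero => simp
  | succ n ih =>
    intro g hg
    rw [pow_succ] at hg
    refine Submodule.mul_induction_on hg ?_ ?_
    · intro a ha b hb
      have := mul_dvd_mul (ih a ha) (h b hb)
      rw [pow_succ, pow_succ]
      convert this using 1
      ring
    · intro a b ha hb
      rw [mul_add]
      exact dvd_add ha hb

variable [IsDomain R]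

theorem IsUniformizer.mem_pow_iff (ht : IsUniformizer m t) {n : ℕ} {s u g : R}
    (hs : s ∉ m) (hu : u ∉ m) (h : s * g = t ^ n * u) (k : ℕ) : g ∈ m ^ k ↔ k ≤ n := by
  constructor
  · intro hg
    by_contra! hlt
    have hg : g ∈ m ^ (n + 1) := Ideal.pow_le_pow_right hlt hg
    obtain ⟨s', hs', h'⟩ := ht.exists_of_mem_pow (n := n + 1)
    obtain ⟨c, hc⟩ := h' g hg
    have e : s' * u = t * (s * c) := by
      apply mul_left_cancel₀ (pow_ne_zero n ht.ne_zero)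
      linear_combination s * hc - s' * h
    have : s' * u ∈ m := by rw [e]; exact Ideal.mul_mem_right _ _ ht.mem
    exact (hm.isPrime.mem_or_mem this).elim hs' hu
  · intro hk
    apply Ideal.pow_le_pow_right hk
    apply mem_pow_of_mul_mem_pow hs
    rw [h]
    exact Ideal.mul_mem_right _ _ (Ideal.pow_mem_pow ht.mem n)

theorem IsUniformizer.idealOrd_eq (ht : IsUniformizer m t) {n : ℕ} {s u g : R}
    (hs : s ∉ m) (hu : u ∉ m) (h : s * g = t ^ n * u) : idealOrd m g = n := by
  have : {k : ℕ | g ∈ m ^ k} = Set.Iic n := by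
    ext k
    exact ht.mem_pow_iff hs hu h k
  rw [idealOrd, this, csSup_Iic]

theorem IsUniformizer.exists_eq [IsNoetherianRing R] (ht : IsUniformizer m t) {g : R}
    (hg : g ≠ 0) : ∃ (n : ℕ) (s u : R), s ∉ m ∧ u ∉ m ∧ s * g = t ^ n * u := by
  -- Krull's intersection theorem: a non-zero element has finite order.
  have hex : ∃ n, g ∉ m ^ n := by
    by_contra! h
    have : g ∈ (⨅ n, m ^ n : Ideal R) := by simpa [Ideal.mem_iInf] using h
    rw [Ideal.iInf_pow_eq_bot_of_isDomain m hm.ne_top] at this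
    exact hg this
  classical
  obtain ⟨n, hn⟩ : ∃ n, Nat.find hex = n + 1 := by
    apply Nat.exists_eq_succ_of_ne_zero
    intro h0
    have := Nat.find_spec hex
    rw [h0] at this
    simp at this
  have h1 : g ∉ m ^ (n + 1) := hn ▸ Nat.find_spec hex
  have h2 : g ∈ m ^ n := by
    by_contra h
    have := Nat.find_min' hex h
    omega
  obtain ⟨s, hs, h⟩ := ht.exists_of_mem_pow (n := n)
  obtain ⟨u, hu⟩ := h g h2
  refine ⟨n, s, u, hs, fun hum => h1 ?_, hu⟩
  apply mem_pow_of_mul_mem_pow hs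
  rw [hu, pow_succ]
  exact Ideal.mul_mem_mul (Ideal.pow_mem_pow ht.mem n) hum

theorem IsUniformizer.idealOrd_mul [IsNoetherianRing R] (ht : IsUniformizer m t) {g h : R}
    (hg : g ≠ 0) (hh : h ≠ 0) : idealOrd m (g * h) = idealOrd m g + idealOrd m h := by
  obtain ⟨n, s, u, hs, hu, e⟩ := ht.exists_eq hg
  obtain ⟨n', s', u', hs', hu', e'⟩ := ht.exists_eq hh
  rw [ht.idealOrd_eq hs hu e, ht.idealOrd_eq hs' hu' e']
  refine ht.idealOrd_eq (s := s * s') (u := u * u') (fun h' => (hm.isPrime.mem_or_mem h').elim hs hs')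
    (fun h' => (hm.isPrime.mem_or_mem h').elim hu hu') ?_
  linear_combination (s' * h) * e + t ^ n * u * e'

theorem IsUniformizer.mem_pow_iff_le_idealOrd [IsNoetherianRing R] (ht : IsUniformizer m t) {g : R}
    (hg : g ≠ 0) {k : ℕ} : g ∈ m ^ k ↔ k ≤ idealOrd m g := by
  obtain ⟨n, s, u, hs, hu, e⟩ := ht.exists_eq hg
  rw [ht.idealOrd_eq hs hu e, ht.mem_pow_iff hs hu e]

end IdealOrd

/-! ### The affine coordinate ring, norms, and orders of polynomial functions. -/

section PolyFun

variable {F : Type*} [Field F] {f : F[X]} {K : Type*} [Field K] [Algebra F K]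

variable (f K) in
/-- The curve `y ^ 2 = f x` is smooth on its affine part, `f` is monic of odd degree, and the
characteristic is not `2`. -/
structure IsOddCurve : Prop where
  monic : f.Monic
  odd : Odd f.natDegree
  separable : f.Separable
  two_ne_zero : (2 : K) ≠ 0

variable (f) in
/-- The norm of `a(x) + y b(x)`. -/
noncomputable def polyNorm (a b : K[X]) : K[X] := a ^ 2 - f.map (algebraMap F K) * b ^ 2

theorem polyNorm_mul (a b c d : K[X]) :
    polyNorm f (a * c + f.map (algebraMap F K) * b * d) (a * d + b * c) =
      polyNorm f a b * polyNorm f c d := by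
  simp only [polyNorm]
  ring

-- The degrees of `a²` and `f b²` have different parity, so their leading terms never cancel. This
-- matches the degree of the norm with the pole order in `Point.ord`.
open Classical in
theorem polyNorm_aux (H : IsOddCurve f K) {a b : K[X]} (h : a ≠ 0 ∨ b ≠ 0) :
    polyNorm f a b ≠ 0 ∧ (polyNorm f a b).natDegree =
      max (2 * a.natDegree) (if b = 0 then 0 else f.natDegree + 2 * b.natDegree) := by
  by_cases hb : b = 0
  · subst hb
    simp at h
    simp [polyNorm, h]
  have hf : f.map (algebraMap F K) ≠ 0 := (H.monic.map _).ne_zero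
  have hd : (f.map (algebraMap F K) * b ^ 2).natDegree = f.natDegree + 2 * b.natDegree := by
    rw [natDegree_mul hf (pow_ne_zero 2 hb), natDegree_pow, H.monic.natDegree_map]
  have ha : (a ^ 2).natDegree = 2 * a.natDegree := natDegree_pow a 2
  obtain ⟨k, hk⟩ := H.odd
  have hdeg : (polyNorm f a b).natDegree =
      max (2 * a.natDegree) (f.natDegree + 2 * b.natDegree) := by
    rcases lt_or_ge (2 * a.natDegree) (f.natDegree + 2 * b.natDegree) with hlt | hge
    · rw [polyNorm, natDegree_sub_eq_right_of_natDegree_lt (by omega), hd]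
      omega
    · rw [polyNorm, natDegree_sub_eq_left_of_natDegree_lt (by omega), ha]
      omega
  rw [if_neg hb]
  refine ⟨fun h0 => ?_, hdeg⟩
  rw [h0, natDegree_zero] at hdeg
  omega

theorem polyNorm_ne_zero (H : IsOddCurve f K) {a b : K[X]} (h : a ≠ 0 ∨ b ≠ 0) :
    polyNorm f a b ≠ 0 := (polyNorm_aux H h).1

theorem ord_infinity (H : IsOddCurve f K) {a b : K[X]} (h : a ≠ 0 ∨ b ≠ 0) :
    Point.ord a b (.infinity : Point f K) = -((polyNorm f a b).natDegree : ℤ) := by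
  rw [(polyNorm_aux H h).2]
  rfl

theorem mul_ne_zero_of_ne_zero (H : IsOddCurve f K) {a b c d : K[X]} (h : a ≠ 0 ∨ b ≠ 0)
    (h' : c ≠ 0 ∨ d ≠ 0) :
    a * c + f.map (algebraMap F K) * b * d ≠ 0 ∨ a * d + b * c ≠ 0 := by
  by_contra! h0
  have := polyNorm_mul (f := f) a b c d
  rw [h0.1, h0.2] at this
  exact mul_ne_zero (polyNorm_ne_zero H h) (polyNorm_ne_zero H h') (by rw [← this]; simp [polyNorm])

theorem root_mul_root :
    (AdjoinRoot.root _ * AdjoinRoot.root _ : CoordRing f K) =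
      AdjoinRoot.of _ (f.map (algebraMap F K)) := by
  have := AdjoinRoot.eval₂_root (X ^ 2 - C (f.map (algebraMap F K)) : K[X][X])
  rw [eval₂_sub, eval₂_X_pow, eval₂_C, sub_eq_zero] at this
  exact (pow_two _).symm.trans this

theorem polyFun_mul (a b c d : K[X]) :
    (polyFun a b * polyFun c d : CoordRing f K) =
      polyFun (a * c + f.map (algebraMap F K) * b * d) (a * d + b * c) := by
  simp only [polyFun, map_add, map_mul, ← root_mul_root]
  ring

theorem polyFun_surjective (g : CoordRing f K) : ∃ a b : K[X], g = polyFun a b := by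
  obtain ⟨p, rfl⟩ := AdjoinRoot.mk_surjective g
  have hm : (X ^ 2 - C (f.map (algebraMap F K)) : K[X][X]).Monic :=
    monic_X_pow_sub_C _ two_ne_zero
  have hd := natDegree_modByMonic_lt p hm (by
    intro h
    have := congrArg natDegree h
    simp at this)
  rw [natDegree_X_pow_sub_C] at hd
  obtain ⟨b, a, e⟩ := exists_eq_X_add_C_of_natDegree_le_one (Nat.le_of_lt_succ hd)
  refine ⟨a, b, ?_⟩
  have e2 := modByMonic_add_div p (X ^ 2 - C (f.map (algebraMap F K)) : K[X][X])
  rw [← e2, map_add, map_mul, AdjoinRoot.mk_self, zero_mul, add_zero, e]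
  simp only [map_add, map_mul, AdjoinRoot.mk_X, AdjoinRoot.mk_C, polyFun]
  ring

theorem polyFun_eq_zero {a b : K[X]} (h : (polyFun a b : CoordRing f K) = 0) : a = 0 ∧ b = 0 := by
  have e : (polyFun a b : CoordRing f K) = AdjoinRoot.mk _ (C b * X + C a) := by
    simp only [map_add, map_mul, AdjoinRoot.mk_X, AdjoinRoot.mk_C, polyFun]
    ring
  rw [e, AdjoinRoot.mk_eq_zero] at h
  have hm : (X ^ 2 - C (f.map (algebraMap F K)) : K[X][X]).Monic :=
    monic_X_pow_sub_C _ two_ne_zero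
  have h0 : (C b * X + C a : K[X][X]) = 0 := by
    by_contra hne
    refine hm.not_dvd_of_natDegree_lt hne ?_ h
    rw [natDegree_X_pow_sub_C]
    exact lt_of_le_of_lt natDegree_linear_le one_lt_two
  have h1 := congrArg (coeff · 1) h0
  have h2 := congrArg (coeff · 0) h0
  simp at h1 h2
  exact ⟨h2, h1⟩

theorem polyFun_ne_zero {a b : K[X]} (h : a ≠ 0 ∨ b ≠ 0) : (polyFun a b : CoordRing f K) ≠ 0 := by
  intro h0
  have := polyFun_eq_zero h0
  tauto

/-- Non-zero functions have non-zero norm, and the norm is multiplicative. -/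
theorem CoordRing.isDomain (H : IsOddCurve f K) : IsDomain (CoordRing f K) := by
  have hnt : Nontrivial (CoordRing f K) :=
    ⟨polyFun 1 0, 0, polyFun_ne_zero (Or.inl one_ne_zero)⟩
  have : NoZeroDivisors (CoordRing f K) := by
    refine ⟨fun {g h} e => ?_⟩
    obtain ⟨a, b, rfl⟩ := polyFun_surjective g
    obtain ⟨c, d, rfl⟩ := polyFun_surjective h
    by_contra! hne
    have h1 : a ≠ 0 ∨ b ≠ 0 := by
      by_contra! h0
      exact hne.1 (by simp [polyFun, h0.1, h0.2])
    have h2 : c ≠ 0 ∨ d ≠ 0 := by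
      by_contra! h0
      exact hne.2 (by simp [polyFun, h0.1, h0.2])
    rw [polyFun_mul] at e
    exact polyFun_ne_zero (mul_ne_zero_of_ne_zero H h1 h2) e
  exact NoZeroDivisors.to_isDomain _

instance : IsNoetherianRing (CoordRing f K) :=
  inferInstanceAs (IsNoetherianRing (K[X][X] ⧸ _))

theorem dvd_sub_C_eval (a : K[X]) (x : K) : X - C x ∣ a - C (a.eval x) := by
  rw [dvd_iff_isRoot]
  simp

theorem polyFun_sub_mem (x y : K) (a b : K[X]) :
    (polyFun a b - polyFun (C (a.eval x + y * b.eval x)) 0 : CoordRing f K) ∈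
      Point.pointIdeal x y := by
  obtain ⟨a', ha⟩ := dvd_sub_C_eval a x
  obtain ⟨b', hb⟩ := dvd_sub_C_eval b x
  rw [Point.pointIdeal, Ideal.mem_span_pair]
  refine ⟨AdjoinRoot.of _ (a' + C y * b') , AdjoinRoot.of _ b, ?_⟩
  have ha := congrArg (AdjoinRoot.of (X ^ 2 - C (f.map (algebraMap F K)) : K[X][X])) ha
  have hb := congrArg (AdjoinRoot.of (X ^ 2 - C (f.map (algebraMap F K)) : K[X][X])) hb
  simp only [polyFun, map_sub, map_add, map_mul, map_zero] at ha hb ⊢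
  linear_combination -ha - (AdjoinRoot.of (X ^ 2 - C (f.map (algebraMap F K)) : K[X][X]) (C y)) * hb

theorem map_eval_eq (f : F[X]) (x : K) : (f.map (algebraMap F K)).eval x = aeval x f := by
  rw [eval_map_algebraMap]

/-- Evaluation at an affine point. -/
noncomputable def evalHom {x y : K} (h : y ^ 2 = aeval x f) : CoordRing f K →+* K :=
  AdjoinRoot.lift (evalRingHom x) y (by simp [h])

theorem evalHom_polyFun {x y : K} (h : y ^ 2 = aeval x f) (a b : K[X]) :
    evalHom h (polyFun a b) = a.eval x + y * b.eval x := by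
  simp [evalHom, polyFun]

theorem pointIdeal_eq_ker {x y : K} (h : y ^ 2 = aeval x f) :
    Point.pointIdeal x y = RingHom.ker (evalHom h) := by
  apply le_antisymm
  · rw [Point.pointIdeal, Ideal.span_le]
    rintro g (rfl | rfl) <;> simp [evalHom]
  · intro g hg
    obtain ⟨a, b, rfl⟩ := polyFun_surjective g
    have h0 : a.eval x + y * b.eval x = 0 := by
      rw [← evalHom_polyFun h]; exact hg
    have := polyFun_sub_mem (f := f) x y a b
    rw [h0] at this
    simpa [polyFun] using this

theorem polyFun_mem_pointIdeal {x y : K} (h : y ^ 2 = aeval x f) {a b : K[X]} :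
    (polyFun a b : CoordRing f K) ∈ Point.pointIdeal x y ↔ a.eval x + y * b.eval x = 0 := by
  rw [pointIdeal_eq_ker h, RingHom.mem_ker, evalHom_polyFun]

theorem pointIdeal_isMaximal {x y : K} (h : y ^ 2 = aeval x f) :
    (Point.pointIdeal (f := f) x y).IsMaximal := by
  rw [pointIdeal_eq_ker h]
  apply RingHom.ker_isMaximal_of_surjective
  intro c
  exact ⟨polyFun (C c) 0, by simp [evalHom_polyFun]⟩

theorem polyFun_dvd_of_dvd {a b c d : K[X]} (e f' : K[X])
    (h : c = a * e + f.map (algebraMap F K) * b * f') (h' : d = a * f' + b * e) :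
    (polyFun a b : CoordRing f K) ∣ polyFun c d :=
  ⟨polyFun e f', by rw [polyFun_mul, h, h']⟩

theorem isUniformizer_X_sub_C (H : IsOddCurve f K) {x y : K} (h : y ^ 2 = aeval x f) (hy : y ≠ 0) :
    IsUniformizer (Point.pointIdeal (f := f) x y) (polyFun (X - C x) 0) := by
  -- The multiplier is `y₀ + y`, with value `2y₀ ≠ 0`. Both components of `(y₀ + y)(a + y b)` vanish
  -- at `x₀` as soon as `a + y b` vanishes at the point.
  refine ⟨?_, polyFun_ne_zero (Or.inl (X_sub_C_ne_zero x)), polyFun (C y) 1, ?_, ?_⟩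
  · rw [polyFun_mem_pointIdeal h]; simp
  · rw [polyFun_mem_pointIdeal h]
    simp only [eval_C, eval_one, mul_one]
    rw [← two_mul]
    exact mul_ne_zero H.two_ne_zero hy
  · intro g hg
    obtain ⟨a, b, rfl⟩ := polyFun_surjective g
    rw [polyFun_mem_pointIdeal h] at hg
    rw [polyFun_mul]
    obtain ⟨c, hc⟩ : X - C x ∣ C y * a + f.map (algebraMap F K) * 1 * b := by
      rw [dvd_iff_isRoot]
      simp only [IsRoot, eval_add, eval_mul, eval_C, map_eval_eq, ← h, eval_one]
      linear_combination y * hg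
    obtain ⟨d, hd⟩ : X - C x ∣ C y * b + 1 * a := by
      rw [dvd_iff_isRoot]
      simp only [IsRoot, eval_add, eval_mul, eval_C, eval_one]
      linear_combination hg
    exact polyFun_dvd_of_dvd c d (by rw [hc]; ring) (by rw [hd]; ring)

theorem exists_eq_X_sub_C_mul (H : IsOddCurve f K) {x : K} (h : aeval x f = 0) :
    ∃ f₁ : K[X], f.map (algebraMap F K) = (X - C x) * f₁ ∧ f₁.eval x ≠ 0 := by
  obtain ⟨f₁, hf⟩ : X - C x ∣ f.map (algebraMap F K) := by
    rw [dvd_iff_isRoot, IsRoot, map_eval_eq, h]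
  refine ⟨f₁, hf, fun h0 => ?_⟩
  have hs := (H.separable.map (f := algebraMap F K)).squarefree
  obtain ⟨f₂, rfl⟩ := dvd_iff_isRoot.2 h0
  refine not_isUnit_X_sub_C x (hs (X - C x) ⟨f₂, ?_⟩)
  rw [hf]; ring

theorem isUniformizer_root (H : IsOddCurve f K) {x : K} (h : (0 : K) ^ 2 = aeval x f) :
    IsUniformizer (Point.pointIdeal (f := f) x 0) (polyFun 0 1) := by
  obtain ⟨f₁, hf, hf₁⟩ := exists_eq_X_sub_C_mul H (h.symm.trans (by simp))
  -- From `y² = (x - x₀) f₁`, multiplication by `f₁`, a local unit, makes `x - x₀` a multiple of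
  -- `y`.
  refine ⟨?_, polyFun_ne_zero (Or.inr one_ne_zero), polyFun f₁ 0, ?_, ?_⟩
  · rw [polyFun_mem_pointIdeal h]; simp
  · rw [polyFun_mem_pointIdeal h]
    simpa using hf₁
  · intro g hg
    obtain ⟨a, b, rfl⟩ := polyFun_surjective g
    rw [polyFun_mem_pointIdeal h] at hg
    rw [polyFun_mul]
    obtain ⟨c, hc⟩ : X - C x ∣ a := by
      rw [dvd_iff_isRoot]
      simpa using hg
    refine polyFun_dvd_of_dvd (f₁ * b) c ?_ ?_
    · rw [hc, hf]; ring
    · ring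

theorem exists_isUniformizer (H : IsOddCurve f K) {x y : K} (h : y ^ 2 = aeval x f) :
    ∃ t, IsUniformizer (Point.pointIdeal (f := f) x y) t := by
  by_cases hy : y = 0
  · subst hy; exact ⟨_, isUniformizer_root H h⟩
  · exact ⟨_, isUniformizer_X_sub_C H h hy⟩

theorem ord_affine {x y : K} (h : y ^ 2 = aeval x f) (a b : K[X]) :
    Point.ord a b (.affine x y h : Point f K) =
      (idealOrd (Point.pointIdeal (f := f) x y) (polyFun a b) : ℤ) := rfl

theorem ord_mul (H : IsOddCurve f K) {a b c d : K[X]} (h : a ≠ 0 ∨ b ≠ 0) (h' : c ≠ 0 ∨ d ≠ 0)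
    (P : Point f K) :
    P.ord (a * c + f.map (algebraMap F K) * b * d) (a * d + b * c) = P.ord a b + P.ord c d := by
  cases P with
  | infinity =>
    rw [ord_infinity H h, ord_infinity H h', ord_infinity H (mul_ne_zero_of_ne_zero H h h'),
      polyNorm_mul, natDegree_mul (polyNorm_ne_zero H h) (polyNorm_ne_zero H h')]
    push_cast
    ring
  | affine x y e =>
    have := CoordRing.isDomain H
    have := pointIdeal_isMaximal e
    obtain ⟨t, ht⟩ := exists_isUniformizer H e
    rw [ord_affine, ord_affine, ord_affine, ← polyFun_mul,
      ht.idealOrd_mul (polyFun_ne_zero h) (polyFun_ne_zero h')]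
    push_cast
    rfl

theorem le_ord_affine_iff (H : IsOddCurve f K) {a b : K[X]} (h : a ≠ 0 ∨ b ≠ 0) {x y : K}
    (e : y ^ 2 = aeval x f) (n : ℕ) : (n : ℤ) ≤ Point.ord a b (.affine x y e : Point f K) ↔
      (polyFun a b : CoordRing f K) ∈ Point.pointIdeal x y ^ n := by
  have := CoordRing.isDomain H
  have := pointIdeal_isMaximal e
  obtain ⟨t, ht⟩ := exists_isUniformizer H e
  rw [ord_affine, ht.mem_pow_iff_le_idealOrd (polyFun_ne_zero h), Nat.cast_le]

theorem one_le_ord_affine_iff (H : IsOddCurve f K) {a b : K[X]} (h : a ≠ 0 ∨ b ≠ 0) {x y : K}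
    (e : y ^ 2 = aeval x f) : 1 ≤ Point.ord a b (.affine x y e : Point f K) ↔
      a.eval x + y * b.eval x = 0 := by
  rw [← polyFun_mem_pointIdeal e]
  simpa using le_ord_affine_iff H h e 1

theorem ord_affine_nonneg {x y : K} (e : y ^ 2 = aeval x f) (a b : K[X]) :
    0 ≤ Point.ord a b (.affine x y e : Point f K) := by
  rw [ord_affine]; positivity

theorem ord_affine_eq_zero (H : IsOddCurve f K) {a b : K[X]} {x y : K}
    (e : y ^ 2 = aeval x f) (h : a.eval x + y * b.eval x ≠ 0) :
    Point.ord a b (.affine x y e : Point f K) = 0 := by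
  have hne : a ≠ 0 ∨ b ≠ 0 := by
    by_contra! h0
    simp [h0.1, h0.2] at h
  have := ord_affine_nonneg e a b
  have := (one_le_ord_affine_iff H hne e).not.2 h
  omega

open Classical in
theorem ord_X_sub_C_self (H : IsOddCurve f K) {x y : K} (e : y ^ 2 = aeval x f) :
    Point.ord (X - C x) 0 (.affine x y e : Point f K) = if y = 0 then 2 else 1 := by
  have := CoordRing.isDomain H
  have := pointIdeal_isMaximal e
  rw [ord_affine]
  split_ifs with hy
  · subst hy
    obtain ⟨f₁, hf, hf₁⟩ := exists_eq_X_sub_C_mul H (e.symm.trans (by simp))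
    rw [(isUniformizer_root H e).idealOrd_eq (n := 2) (s := polyFun f₁ 0) (u := polyFun 1 0)]
    · rfl
    · rw [polyFun_mem_pointIdeal e]; simpa using hf₁
    · rw [polyFun_mem_pointIdeal e]; simp
    · rw [pow_two (polyFun 0 1), polyFun_mul, polyFun_mul, polyFun_mul, hf]
      congr 1 <;> ring
  · rw [(isUniformizer_X_sub_C H e hy).idealOrd_eq (n := 1) (s := polyFun 1 0) (u := polyFun 1 0)]
    · rfl
    · rw [polyFun_mem_pointIdeal e]; simp
    · rw [polyFun_mem_pointIdeal e]; simp
    · rw [pow_one, polyFun_mul, polyFun_mul]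
      congr 1 <;> ring

theorem ord_poly_mul (H : IsOddCurve f K) {a b : K[X]} (ha : a ≠ 0) (hb : b ≠ 0)
    (P : Point f K) : P.ord (a * b) 0 = P.ord a 0 + P.ord b 0 := by
  rw [← ord_mul H (Or.inl ha) (Or.inl hb)]
  congr 1 <;> ring

theorem ord_poly_mul_polyFun (H : IsOddCurve f K) {n a b : K[X]} (hn : n ≠ 0) (h : a ≠ 0 ∨ b ≠ 0)
    (P : Point f K) : P.ord (n * a) (n * b) = P.ord n 0 + P.ord a b := by
  rw [← ord_mul H (Or.inl hn) h]
  congr 1 <;> ring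

open Classical in
theorem ord_poly (H : IsOddCurve f K) {a : K[X]} (ha : a ≠ 0) {x y : K} (e : y ^ 2 = aeval x f) :
    Point.ord a 0 (.affine x y e : Point f K) =
      (a.rootMultiplicity x : ℤ) * if y = 0 then 2 else 1 := by
  obtain ⟨a₁, h, h₁⟩ := exists_eq_pow_rootMultiplicity_mul_and_not_dvd a ha x
  have hx : ∀ n : ℕ, Point.ord ((X - C x) ^ n) 0 (.affine x y e : Point f K) =
      (n : ℤ) * if y = 0 then 2 else 1 := by
    intro n
    induction n with
    | zero =>
      rw [pow_zero, ord_affine_eq_zero H]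
      · simp
      · simp
    | succ n ih =>
      rw [pow_succ, ord_poly_mul H (pow_ne_zero _ (X_sub_C_ne_zero x)) (X_sub_C_ne_zero x), ih,
        ord_X_sub_C_self H]
      push_cast
      ring
  rw [dvd_iff_isRoot, IsRoot] at h₁
  have ha₁ : a₁ ≠ 0 := by rintro rfl; simp at h₁
  conv_lhs => rw [h]
  rw [ord_poly_mul H (pow_ne_zero _ (X_sub_C_ne_zero x)) ha₁, hx,
    ord_affine_eq_zero H e (a := a₁) (by simpa using h₁), add_zero]

end PolyFun

/-! ### Principal divisors and functions without affine poles. -/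

section Principal

variable {F : Type*} [Field F] {f : F[X]} {K : Type*} [Field K] [Algebra F K]

theorem conj_ne_zero {a b : K[X]} (h : a ≠ 0 ∨ b ≠ 0) : a ≠ 0 ∨ -b ≠ 0 :=
  h.imp_right neg_ne_zero.2

theorem ord_add_ord_conj (H : IsOddCurve f K) {a b : K[X]} (h : a ≠ 0 ∨ b ≠ 0) (P : Point f K) :
    P.ord a b + P.ord a (-b) = P.ord (polyNorm f a b) 0 := by
  rw [← ord_mul H h (conj_ne_zero h), polyNorm]
  congr 1 <;> ring

theorem exists_ord_of_mem_principal (H : IsOddCurve f K) {D : Divisor f K}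
    (hD : D ∈ principal f K) : ∃ a b c d : K[X], (a ≠ 0 ∨ b ≠ 0) ∧ (c ≠ 0 ∨ d ≠ 0) ∧
      ∀ P : Point f K, D P = P.ord a b - P.ord c d := by
  refine AddSubgroup.closure_induction ?_ ?_ ?_ ?_ hD
  · rintro D ⟨a, b, h, hD⟩
    refine ⟨a, b, 1, 0, h, Or.inl one_ne_zero, fun P => ?_⟩
    have := ord_mul H h (c := 1) (d := 0) (Or.inl one_ne_zero) P
    rw [show a * 1 + f.map (algebraMap F K) * b * 0 = a by ring,
      show a * 0 + b * 1 = b by ring] at this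
    rw [hD P]
    omega
  · exact ⟨1, 0, 1, 0, Or.inl one_ne_zero, Or.inl one_ne_zero, fun P => by simp⟩
  · rintro D D' - - ⟨a, b, c, d, h, h', e⟩ ⟨a', b', c', d', k, k', e'⟩
    refine ⟨_, _, _, _, mul_ne_zero_of_ne_zero H h k, mul_ne_zero_of_ne_zero H h' k', fun P => ?_⟩
    rw [ord_mul H h k, ord_mul H h' k', Finsupp.add_apply, e, e']
    ring
  · rintro D - ⟨a, b, c, d, h, h', e⟩
    refine ⟨c, d, a, b, h', h, fun P => ?_⟩
    rw [Finsupp.neg_apply, e]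
    ring

theorem exists_affine [IsAlgClosed K] (f : F[X]) (x : K) : ∃ y : K, y ^ 2 = aeval x f :=
  IsAlgClosed.exists_pow_nat_eq _ two_pos

/-- Away from Weierstrass points, vanishing at both points above `x` kills `a(x)` and `b(x)` because
`2y ≠ 0`. At a Weierstrass point, if `b(x) ≠ 0` the norm has at most a simple root, while the
function and its conjugate would have total order at least 3 instead of at most 2. -/
theorem dvd_of_ord_le (H : IsOddCurve f K) {a b : K[X]} (h : a ≠ 0 ∨ b ≠ 0) {x y : K}
    (e : y ^ 2 = aeval x f)
    (hle : ∀ P : Point f K, P ≠ .infinity → P.ord (X - C x) 0 ≤ P.ord a b) :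
    X - C x ∣ a ∧ X - C x ∣ b := by
  classical
  simp only [dvd_iff_isRoot, IsRoot]
  have h1 := hle (.affine x y e) (by simp)
  rw [ord_X_sub_C_self H] at h1
  have ha : a.eval x + y * b.eval x = 0 := by
    rw [← one_le_ord_affine_iff H h e]
    split_ifs at h1 <;> omega
  by_cases hy : y = 0
  · subst hy
    have ha : a.eval x = 0 := by simpa using ha
    refine ⟨ha, ?_⟩
    by_contra hb
    have hc := ord_add_ord_conj H h (.affine x 0 e)
    rw [ord_poly H (polyNorm_ne_zero H h)] at hc
    have h2 := (one_le_ord_affine_iff H (conj_ne_zero h) e).2 (by simpa using ha)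
    obtain ⟨f₁, hf, hf₁⟩ := exists_eq_X_sub_C_mul H (e.symm.trans (by simp))
    obtain ⟨a', rfl⟩ := dvd_iff_isRoot.2 ha
    have hm : (polyNorm f ((X - C x) * a') b).rootMultiplicity x ≤ 1 := by
      rw [rootMultiplicity_le_iff (polyNorm_ne_zero H h)]
      rintro ⟨q, hq⟩
      have : (X - C x) * (a' ^ 2 * (X - C x) - f₁ * b ^ 2) = (X - C x) * ((X - C x) * q) := by
        rw [polyNorm, hf] at hq
        linear_combination hq
      have := congrArg (eval x) (mul_left_cancel₀ (X_sub_C_ne_zero x) this)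
      simp at this
      tauto
    simp only [if_true] at h1 hc
    omega
  · have e' : (-y) ^ 2 = aeval x f := by rw [neg_sq, e]
    have h1 := hle (.affine x (-y) e') (by simp)
    rw [ord_X_sub_C_self H] at h1
    have hb : a.eval x + -y * b.eval x = 0 := by
      rw [← one_le_ord_affine_iff H h e']
      split_ifs at h1 <;> omega
    have h2 : (2 * y) * b.eval x = 0 := by linear_combination ha - hb
    have h3 : b.eval x = 0 := by simpa [H.two_ne_zero, hy] using h2
    rw [h3] at ha
    exact ⟨by simpa using ha, h3⟩

theorem ord_C (H : IsOddCurve f K) {c : K} (hc : c ≠ 0) (P : Point f K) : P.ord (C c) 0 = 0 := by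
  cases P with
  | infinity => simp [Point.ord]
  | affine x y e => exact ord_affine_eq_zero H e (by simpa using hc)

theorem ord_poly_nonneg {a : K[X]} {P : Point f K} (hP : P ≠ .infinity) (b : K[X]) :
    0 ≤ P.ord a b := by
  cases P with
  | infinity => simp at hP
  | affine x y e => exact ord_affine_nonneg e a b

/-- A polynomial in `x` divides a polynomial function if it does so locally at all affine points. -/
theorem poly_dvd_of_ord_le [IsAlgClosed K] (H : IsOddCurve f K) {n a b : K[X]} (hn : n ≠ 0)
    (h : a ≠ 0 ∨ b ≠ 0) (hle : ∀ P : Point f K, P ≠ .infinity → P.ord n 0 ≤ P.ord a b) :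
    n ∣ a ∧ n ∣ b := by
  induction hk : n.natDegree generalizing n a b with
  | zero =>
    obtain ⟨c, rfl⟩ := natDegree_eq_zero.1 hk
    have : IsUnit (C c) := isUnit_C.2 (isUnit_iff_ne_zero.2 (by simpa using hn))
    exact ⟨this.dvd, this.dvd⟩
  | succ k ih =>
    obtain ⟨x, hx⟩ := IsAlgClosed.exists_root n (by
      rw [degree_eq_natDegree hn, hk]
      simp [Nat.cast_add_one_ne_zero])
    obtain ⟨n', rfl⟩ := dvd_iff_isRoot.2 hx
    have hn' : n' ≠ 0 := right_ne_zero_of_mul hn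
    obtain ⟨y, hy⟩ := exists_affine f x
    obtain ⟨⟨a', rfl⟩, ⟨b', rfl⟩⟩ := dvd_of_ord_le H h hy (by
      intro P hP
      have h1 := hle P hP
      rw [ord_poly_mul H (X_sub_C_ne_zero x) hn'] at h1
      have := ord_poly_nonneg (a := n') hP 0
      omega)
    have h' : a' ≠ 0 ∨ b' ≠ 0 := h.imp right_ne_zero_of_mul right_ne_zero_of_mul
    have := ih hn' h' (fun P hP => by
      have := hle P hP
      rw [ord_poly_mul H (X_sub_C_ne_zero x) hn',
        ord_poly_mul_polyFun H (X_sub_C_ne_zero x) h'] at this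
      omega) (by
      rw [natDegree_mul (X_sub_C_ne_zero x) hn', natDegree_X_sub_C] at hk
      omega)
    exact ⟨mul_dvd_mul_left _ this.1, mul_dvd_mul_left _ this.2⟩

/-- A principal divisor whose only pole is at infinity is the divisor of a polynomial function. -/
theorem exists_isDivOf [IsAlgClosed K] (H : IsOddCurve f K) {D : Divisor f K}
    (hD : ∀ P, P ≠ .infinity → 0 ≤ D P) (hp : D ∈ principal f K) : ∃ a b, IsDivOf a b D := by
  obtain ⟨a, b, c, d, h, h', e⟩ := exists_ord_of_mem_principal H hp
  -- Rationalize the denominator: multiplying by the conjugate of `c + y d` leaves a polynomial in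
  -- `x` below, which can be divided out.
  have hc := mul_ne_zero_of_ne_zero H h (conj_ne_zero h')
  have hN := polyNorm_ne_zero H h'
  have key : ∀ P : Point f K, D P + P.ord (polyNorm f c d) 0 = P.ord _ _ := fun P => by
    rw [ord_mul H h (conj_ne_zero h'), ← ord_add_ord_conj H h', e]
    ring
  obtain ⟨⟨a', ha⟩, ⟨b', hb⟩⟩ := poly_dvd_of_ord_le H hN hc fun P hP => by
    have := key P
    have := hD P hP
    omega
  rw [ha, hb] at hc key
  have hne : a' ≠ 0 ∨ b' ≠ 0 := hc.imp right_ne_zero_of_mul right_ne_zero_of_mul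
  refine ⟨a', b', hne, fun P => ?_⟩
  have := key P
  rw [ord_poly_mul_polyFun H hN hne] at this
  omega

theorem eq_C_of_ord_infinity_eq_zero (H : IsOddCurve f K) {a b : K[X]} (h : a ≠ 0 ∨ b ≠ 0)
    (h0 : Point.ord a b (.infinity : Point f K) = 0) : b = 0 ∧ ∃ k : K, a = C k := by
  rw [ord_infinity H h] at h0
  have h2 := (polyNorm_aux H h).2
  have hodd := H.odd.pos
  split_ifs at h2 with hb
  · obtain ⟨k, hk⟩ := natDegree_eq_zero.1 (show a.natDegree = 0 by omega)
    exact ⟨hb, k, hk.symm⟩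
  · omega

/-- Two polynomial functions with the same divisor differ by a constant factor. -/
theorem IsDivOf.exists_C_mul [IsAlgClosed K] (H : IsOddCurve f K) {D : Divisor f K}
    {a b c d : K[X]} (h : IsDivOf a b D) (h' : IsDivOf c d D) :
    ∃ k : K, c = C k * a ∧ d = C k * b := by
  have hN := polyNorm_ne_zero H h.1
  have hc := mul_ne_zero_of_ne_zero H h'.1 (conj_ne_zero h.1)
  have key : ∀ P : Point f K, P.ord (polyNorm f a b) 0 = P.ord _ _ := fun P => by
    rw [ord_mul H h'.1 (conj_ne_zero h.1), ← ord_add_ord_conj H h.1, ← h.2, ← h'.2]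
  obtain ⟨⟨a', ha⟩, ⟨b', hb⟩⟩ := poly_dvd_of_ord_le H hN hc fun P _ => (key P).le
  rw [ha, hb] at hc key
  have hne : a' ≠ 0 ∨ b' ≠ 0 := hc.imp right_ne_zero_of_mul right_ne_zero_of_mul
  obtain ⟨rfl, k, rfl⟩ := eq_C_of_ord_infinity_eq_zero H hne (by
    have := key .infinity
    rw [ord_poly_mul_polyFun H hN hne] at this
    omega)
  refine ⟨k, mul_right_cancel₀ hN ?_, mul_right_cancel₀ hN ?_⟩
  · simp only [polyNorm] at ha ⊢
    linear_combination a * ha + f.map (algebraMap F K) * b * hb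
  · simp only [polyNorm] at ha ⊢
    linear_combination a * hb + b * ha

theorem Point.w_w (P : Point f K) : P.w.w = P := by
  cases P <;> simp [Point.w]

theorem Point.w_eq_iff {P Q : Point f K} : P.w = Q ↔ P = Q.w := by
  constructor <;> rintro rfl <;> simp [Point.w_w]

theorem Point.w_injective : Function.Injective (Point.w : Point f K → Point f K) :=
  fun P Q h => by rw [← P.w_w, h, Q.w_w]

@[simp]
theorem Point.w_eq_infinity {P : Point f K} : P.w = .infinity ↔ P = .infinity := by
  cases P <;> simp [Point.w]

theorem ord_X_sub_C_infinity (x : K) :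
    Point.ord (X - C x) 0 (.infinity : Point f K) = -2 := by
  simp [Point.ord]

theorem isDivOf_X_sub_C (H : IsOddCurve f K) {x y : K} (e : y ^ 2 = aeval x f) :
    IsDivOf (X - C x) 0 (pairDiv (.affine x y e : Point f K) (Point.affine x y e).w) := by
  classical
  refine ⟨Or.inl (X_sub_C_ne_zero x), fun P => ?_⟩
  cases P with
  | infinity => simp [ord_X_sub_C_infinity, pairDiv, Point.w]
  | affine x' y' e' =>
    simp only [pairDiv, Point.w, Finsupp.coe_add, Finsupp.coe_sub, Pi.add_apply, Pi.sub_apply,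
      Finsupp.single_apply, Point.affine.injEq, reduceCtorEq, if_false, sub_zero]
    by_cases hx : x = x'
    · subst hx
      have hyy : y' = y ∨ y' = -y := sq_eq_sq_iff_eq_or_eq_neg.1 (by rw [e, e'])
      rw [ord_X_sub_C_self H]
      have h2 : y = -y ↔ y = 0 := by
        constructor
        · intro h
          have : 2 * y = 0 := by linear_combination h
          simpa [H.two_ne_zero] using this
        · rintro rfl; simp
      rcases hyy with rfl | rfl
      · by_cases hy : y' = 0 <;> simp [hy, h2, neg_eq_iff_eq_neg]
      · by_cases hy : y = 0 <;> simp [hy, h2]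
    · rw [ord_affine_eq_zero H e']
      · simp [hx]
      · simpa [sub_eq_zero] using Ne.symm hx

theorem rootMultiplicity_prod_X_sub_C {ι : Type*} [DecidableEq K] (s : Finset ι) (xs : ι → K)
    (x : K) : (∏ i ∈ s, (X - C (xs i))).rootMultiplicity x =
      ∑ i ∈ s, if xs i = x then 1 else 0 := by
  classical
  induction s using Finset.induction_on with
  | empty => simp [← C_1, -map_one]
  | insert i s hi ih =>
    rw [Finset.prod_insert hi, Finset.sum_insert hi, rootMultiplicity_mul, ih,
      rootMultiplicity_X_sub_C]
    · simp [eq_comm]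
    · exact mul_ne_zero (X_sub_C_ne_zero _) <| Finset.prod_ne_zero_iff.2 fun j _ => X_sub_C_ne_zero _

/-- The order of `y - v(x)` at a point of its graph is the multiplicity of the root of the norm. -/
theorem ord_graph (H : IsOddCurve f K) {x y : K} (e : y ^ 2 = aeval x f) {v : K[X]}
    (hv : v.eval x = y) : Point.ord (-v) 1 (.affine x y e : Point f K) =
      (v ^ 2 - f.map (algebraMap F K)).rootMultiplicity x := by
  classical
  have hne : -v ≠ 0 ∨ (1 : K[X]) ≠ 0 := Or.inr one_ne_zero
  have hN : polyNorm f (-v) 1 = v ^ 2 - f.map (algebraMap F K) := by rw [polyNorm]; ring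
  have hsum := ord_add_ord_conj H hne (.affine x y e)
  have hN0 := polyNorm_ne_zero H hne
  rw [hN] at hsum hN0
  rw [ord_poly H hN0] at hsum
  -- At a Weierstrass point the function and its conjugate both vanish and the norm has a simple
  -- root, so each order is 1; elsewhere the conjugate does not vanish.
  by_cases hy : y = 0
  · subst hy
    rw [if_pos rfl] at hsum
    have h1 := (one_le_ord_affine_iff H hne e).2 (by simp [hv])
    have h2 := (one_le_ord_affine_iff H (conj_ne_zero hne) e).2 (by simp [hv])
    have hm : (v ^ 2 - f.map (algebraMap F K)).rootMultiplicity x ≤ 1 := by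
      obtain ⟨f₁, hf, hf₁⟩ := exists_eq_X_sub_C_mul H (e.symm.trans (by simp))
      obtain ⟨v', rfl⟩ := dvd_iff_isRoot.2 hv
      rw [rootMultiplicity_le_iff hN0]
      rintro ⟨q, hq⟩
      have : (X - C x) * (v' ^ 2 * (X - C x) - f₁) = (X - C x) * ((X - C x) * q) := by
        rw [hf] at hq
        linear_combination hq
      have := congrArg (eval x) (mul_left_cancel₀ (X_sub_C_ne_zero x) this)
      simp at this
      tauto
    omega
  · rw [if_neg hy, mul_one] at hsum
    rw [← hsum, ord_affine_eq_zero H e (a := -v) (b := -1), add_zero]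
    simp only [eval_neg, hv, eval_one]
    have : 2 * y ≠ 0 := mul_ne_zero H.two_ne_zero hy
    contrapose! this
    linear_combination -this

/-- The norm of `y - v` splits into the listed `x`-coordinates, and it determines both the affine
orders on the graph and the pole order. -/
theorem isDivOf_graph (H : IsOddCurve f K) {n : ℕ} {xs ys : Fin n → K}
    (e : ∀ i, ys i ^ 2 = aeval (xs i) f) {v : K[X]} (hv : ∀ i, v.eval (xs i) = ys i) {c : K}
    (hN : v ^ 2 - f.map (algebraMap F K) = C c * ∏ i, (X - C (xs i))) :
    IsDivOf (-v) 1 (∑ i, Finsupp.single (.affine (xs i) (ys i) (e i)) 1 -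
      Finsupp.single .infinity (n : ℤ) : Divisor f K) := by
  classical
  have hne : -v ≠ 0 ∨ (1 : K[X]) ≠ 0 := Or.inr one_ne_zero
  have hN0 := polyNorm_ne_zero H hne
  have hNe : polyNorm f (-v) 1 = C c * ∏ i, (X - C (xs i)) := by rw [← hN, polyNorm]; ring
  refine ⟨hne, fun P => ?_⟩
  have hc : c ≠ 0 := by
    rintro rfl
    rw [hNe] at hN0
    simp at hN0
  cases P with
  | infinity =>
    rw [ord_infinity H hne, hNe, natDegree_C_mul hc, natDegree_prod_of_monic _ _
      fun i _ => monic_X_sub_C _]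
    simp
  | affine x y e' =>
    simp only [Finsupp.coe_sub, Pi.sub_apply, Finsupp.finsetSum_apply, Finsupp.single_apply,
      reduceCtorEq, if_false, sub_zero, Point.affine.injEq]
    by_cases hy : v.eval x = y
    · rw [ord_graph H e' hy, hN, rootMultiplicity_mul (by rw [← hNe]; exact hN0),
        rootMultiplicity_C, zero_add, rootMultiplicity_prod_X_sub_C]
      push_cast
      refine Finset.sum_congr rfl fun i _ => ?_
      by_cases hx : xs i = x
      · simp [hx, ← hy, ← hv i]
      · simp [hx]
    · rw [ord_affine_eq_zero H e']
      · refine Finset.sum_eq_zero fun i _ => if_neg ?_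
        rintro ⟨rfl, rfl⟩
        exact hy (hv i)
      · simp only [eval_neg, eval_one, mul_one]
        intro h
        exact hy (by linear_combination -h)

end Principal

/-! ### Divisor classes and existence of reduced representatives. -/

section Classes

variable {F : Type*} [Field F] {f : F[X]} {K : Type*} [Field K] [Algebra F K]

/-- The class of `P - 𝒪`. -/
noncomputable def ptClass (P : Point f K) : ClassGroup f K :=
  toClass f K (Finsupp.single P 1 - Finsupp.single .infinity 1)

theorem toClass_eq_zero {D : Divisor f K} : toClass f K D = 0 ↔ D ∈ principal f K :=
  QuotientAddGroup.eq_zero_iff D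

theorem toClass_eq_iff {D D' : Divisor f K} :
    toClass f K D = toClass f K D' ↔ D - D' ∈ principal f K := by
  rw [← sub_eq_zero, ← map_sub, toClass_eq_zero]

theorem IsDivOf.mem_principal {a b : K[X]} {D : Divisor f K} (h : IsDivOf a b D) :
    D ∈ principal f K :=
  AddSubgroup.subset_closure ⟨a, b, h⟩

@[simp]
theorem ptClass_infinity : ptClass (.infinity : Point f K) = 0 := by
  simp [ptClass]

theorem sum_single_sub_eq {n : ℕ} (P : Fin n → Point f K) :
    ∑ i, Finsupp.single (P i) 1 - Finsupp.single .infinity (n : ℤ) =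
      ∑ i, (Finsupp.single (P i) 1 - Finsupp.single .infinity 1 : Divisor f K) := by
  rw [Finset.sum_sub_distrib, Finset.sum_const, Finset.card_univ, Fintype.card_fin,
    Finsupp.smul_single]
  simp

theorem toClass_sum {n : ℕ} (P : Fin n → Point f K) :
    toClass f K (∑ i, Finsupp.single (P i) 1 - Finsupp.single .infinity (n : ℤ)) =
      ∑ i, ptClass (P i) := by
  rw [sum_single_sub_eq, map_sum]
  rfl

theorem pairDiv_eq (P Q : Point f K) : pairDiv P Q =
    (Finsupp.single P 1 - Finsupp.single .infinity 1) +
      (Finsupp.single Q 1 - Finsupp.single .infinity 1) := by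
  rw [pairDiv, show (2 : ℤ) = 1 + 1 from rfl, Finsupp.single_add]
  abel

theorem toClass_pairDiv (P Q : Point f K) :
    toClass f K (pairDiv P Q) = ptClass P + ptClass Q := by
  rw [pairDiv_eq, map_add]
  rfl

theorem ptClass_w (H : IsOddCurve f K) (P : Point f K) : ptClass P.w = -ptClass P := by
  cases P with
  | infinity => simp [Point.w]
  | affine x y e =>
    rw [eq_neg_iff_add_eq_zero, add_comm, ← toClass_pairDiv, toClass_eq_zero]
    exact (isDivOf_X_sub_C H e).mem_principal

/-- Newton interpolation with multiplicities: adding a multiple of `u` to `v` preserves the earlier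
conditions and leaves one parameter for the new point. -/
theorem exists_interpolation_step (H : IsOddCurve f K) {u v : K[X]}
    (hu : u ∣ v ^ 2 - f.map (algebraMap F K)) {x y : K} (e : y ^ 2 = aeval x f)
    (huv : u.eval x = 0 → v.eval x = y ∧ y ≠ 0) :
    ∃ k : K, u * (X - C x) ∣ (v + C k * u) ^ 2 - f.map (algebraMap F K) ∧
      (v + C k * u).eval x = y := by
  obtain ⟨w, hw⟩ := hu
  have h1 (k : K) : (v + C k * u) ^ 2 - f.map (algebraMap F K) =
      u * (w + 2 * C k * v + C k ^ 2 * u) := by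
    linear_combination hw
  have hx := congrArg (eval x) hw
  simp only [eval_sub, eval_pow, eval_mul, map_eval_eq, ← e] at hx
  by_cases h0 : u.eval x = 0
  · obtain ⟨hv, hy⟩ := huv h0
    -- The value at `x` is already right, so `k` solves `w(x) + 2ky = 0`, raising the multiplicity
    -- as in Hensel lifting.
    refine ⟨-w.eval x / (2 * y), ?_, by simp [h0, hv]⟩
    rw [h1]
    refine mul_dvd_mul_left _ (dvd_iff_isRoot.2 ?_)
    have := H.two_ne_zero
    simp only [IsRoot, eval_add, eval_mul, eval_pow, eval_C, h0, hv, eval_ofNat]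
    field_simp
    ring
  · refine ⟨(y - v.eval x) / u.eval x, ?_, ?_⟩
    · rw [h1]
      refine mul_dvd_mul_left _ (dvd_iff_isRoot.2 ?_)
      simp only [IsRoot, eval_add, eval_mul, eval_pow, eval_C, eval_ofNat]
      field_simp
      linear_combination -hx
    · simp only [eval_add, eval_mul, eval_C]
      field_simp
      ring

theorem eq_and_ne_zero_of_ne_w {x y x' y' : K} (e : y ^ 2 = aeval x f) (e' : y' ^ 2 = aeval x' f)
    (h : (.affine x y e : Point f K) ≠ (Point.affine x' y' e').w) (hx : x = x') :
    y' = y ∧ y ≠ 0 := by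
  subst hx
  simp only [Point.w, ne_eq, Point.affine.injEq, true_and] at h
  have : y = y' := (sq_eq_sq_iff_eq_or_eq_neg.1 (e.trans e'.symm)).resolve_right h
  subst this
  refine ⟨rfl, ?_⟩
  rintro rfl
  simp at h

theorem exists_interpolation (H : IsOddCurve f K) {x₁ y₁ x₂ y₂ x₃ y₃ : K}
    (e₁ : y₁ ^ 2 = aeval x₁ f) (e₂ : y₂ ^ 2 = aeval x₂ f) (e₃ : y₃ ^ 2 = aeval x₃ f)
    (h₂₁ : (.affine x₂ y₂ e₂ : Point f K) ≠ (Point.affine x₁ y₁ e₁).w)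
    (h₃₁ : (.affine x₃ y₃ e₃ : Point f K) ≠ (Point.affine x₁ y₁ e₁).w)
    (h₃₂ : (.affine x₃ y₃ e₃ : Point f K) ≠ (Point.affine x₂ y₂ e₂).w) :
    ∃ v : K[X], v.natDegree ≤ 2 ∧ v.eval x₁ = y₁ ∧ v.eval x₂ = y₂ ∧ v.eval x₃ = y₃ ∧
      (X - C x₁) * (X - C x₂) * (X - C x₃) ∣ v ^ 2 - f.map (algebraMap F K) := by
  have h1 : X - C x₁ ∣ (C y₁) ^ 2 - f.map (algebraMap F K) := by
    rw [dvd_iff_isRoot]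
    simp [e₁]
  obtain ⟨k, h2, hk⟩ := exists_interpolation_step H h1 e₂ (fun h => by
    have := eq_and_ne_zero_of_ne_w e₂ e₁ h₂₁ (by simpa [sub_eq_zero] using h)
    simpa using this)
  obtain ⟨l, h3, hl⟩ := exists_interpolation_step H h2 e₃ (fun h => by
    rw [eval_mul, mul_eq_zero] at h
    rcases h with h | h
    · obtain ⟨rfl, h'⟩ := eq_and_ne_zero_of_ne_w e₃ e₁ h₃₁ (by simpa [sub_eq_zero] using h)
      have h : x₃ = x₁ := by simpa [sub_eq_zero] using h
      simp [h, h']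
    · have hx : x₃ = x₂ := by simpa [sub_eq_zero] using h
      obtain ⟨rfl, h'⟩ := eq_and_ne_zero_of_ne_w e₃ e₂ h₃₂ hx
      exact ⟨by rw [hx, hk], h'⟩)
  refine ⟨_, ?_, ?_, ?_, hl, h3⟩
  · compute_degree
  · simp
  · rw [eval_add, hk]; simp

theorem exists_eq_C_mul_of_natDegree_two [IsAlgClosed K] {p : K[X]} (hp : p.natDegree = 2) :
    ∃ c a b : K, p = C c * ((X - C a) * (X - C b)) := by
  have hp0 : p ≠ 0 := by rintro rfl; simp at hp
  have hs : p.Splits := IsAlgClosed.splits p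
  have hc := hs.natDegree_eq_card_roots
  rw [hp] at hc
  obtain ⟨a, b, hab⟩ := Multiset.card_eq_two.1 hc.symm
  refine ⟨p.leadingCoeff, a, b, ?_⟩
  conv_lhs => rw [hs.eq_prod_roots, hab]
  simp

/-- Cancel an opposite pair or drop `𝒪` if possible. Otherwise interpolate by `v` with `deg v ≤ 2`:
then `v² - f` has degree exactly 5, so `y = v(x)` meets the curve in two further points, whose
reflections represent the sum. -/
theorem exists_add_eq_of_three [IsAlgClosed K] (H : IsOddCurve f K) (hdeg : f.natDegree = 5)
    (P₁ P₂ P₃ : Point f K) :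
    ∃ Q R : Point f K, ptClass P₁ + ptClass P₂ + ptClass P₃ = ptClass Q + ptClass R := by
  by_cases h₂₁ : P₂ = P₁.w
  · exact ⟨P₃, .infinity, by rw [h₂₁, ptClass_w H, ptClass_infinity]; abel⟩
  by_cases h₃₁ : P₃ = P₁.w
  · exact ⟨P₂, .infinity, by rw [h₃₁, ptClass_w H, ptClass_infinity]; abel⟩
  by_cases h₃₂ : P₃ = P₂.w
  · exact ⟨P₁, .infinity, by rw [h₃₂, ptClass_w H, ptClass_infinity]; abel⟩
  rcases P₁ with _ | ⟨x₁, y₁, e₁⟩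
  · exact ⟨P₂, P₃, by simp⟩
  rcases P₂ with _ | ⟨x₂, y₂, e₂⟩
  · exact ⟨.affine x₁ y₁ e₁, P₃, by simp⟩
  rcases P₃ with _ | ⟨x₃, y₃, e₃⟩
  · exact ⟨.affine x₁ y₁ e₁, .affine x₂ y₂ e₂, by simp⟩
  obtain ⟨v, hv, hv₁, hv₂, hv₃, u', hu'⟩ := exists_interpolation H e₁ e₂ e₃ h₂₁ h₃₁ h₃₂
  have hN : (v ^ 2 - f.map (algebraMap F K)).natDegree = 5 := by
    have hf : (f.map (algebraMap F K)).natDegree = 5 := by rw [H.monic.natDegree_map, hdeg]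
    have hv2 : (v ^ 2).natDegree = 2 * v.natDegree := natDegree_pow _ _
    rw [natDegree_sub_eq_right_of_natDegree_lt (by omega), hf]
  have hm : ((X - C x₁) * (X - C x₂) * (X - C x₃)).Monic :=
    ((monic_X_sub_C _).mul (monic_X_sub_C _)).mul (monic_X_sub_C _)
  have hu0 : u' ≠ 0 := by rintro rfl; rw [hu', mul_zero] at hN; simp at hN
  have hu2 : u'.natDegree = 2 := by
    rw [hu', hm.natDegree_mul' hu0, natDegree_mul (by simp [X_sub_C_ne_zero]) (X_sub_C_ne_zero _),
      natDegree_mul (X_sub_C_ne_zero _) (X_sub_C_ne_zero _)] at hN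
    simp only [natDegree_X_sub_C] at hN
    omega
  obtain ⟨c, a, b, rfl⟩ := exists_eq_C_mul_of_natDegree_two hu2
  have hroot {r : K} (h : (X - C r) ∣ v ^ 2 - f.map (algebraMap F K)) :
      v.eval r ^ 2 = aeval r f := by
    rw [dvd_iff_isRoot] at h
    simpa [sub_eq_zero] using h
  have ea : v.eval a ^ 2 = aeval a f := hroot <| by
    rw [hu']
    exact ((Dvd.intro _ rfl).mul_left _).mul_left _
  have eb : v.eval b ^ 2 = aeval b f := hroot <| by
    rw [hu']
    exact ((Dvd.intro_left _ rfl).mul_left _).mul_left _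
  have e : ∀ i, (![y₁, y₂, y₃, v.eval a, v.eval b] : Fin 5 → K) i ^ 2 =
      aeval ((![x₁, x₂, x₃, a, b] : Fin 5 → K) i) f := by
    intro i; fin_cases i <;> assumption
  have hd := isDivOf_graph H e (v := v) (by intro i; fin_cases i <;> first | assumption | rfl)
    (c := c) (by rw [hu', Fin.prod_univ_five]; simp; ring)
  have hs := toClass_eq_zero.2 hd.mem_principal
  rw [toClass_sum, Fin.sum_univ_five] at hs
  refine ⟨(Point.affine a _ ea).w, (Point.affine b _ eb).w, ?_⟩
  rw [ptClass_w H, ptClass_w H, ← sub_eq_zero, ← hs]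
  simp only [Matrix.cons_val]
  abel

/-- Every class of degree zero is the class of `P + Q - 2𝒪` for some `P` and `Q`. -/
theorem exists_ptClass_add_ptClass [IsAlgClosed K] (H : IsOddCurve f K) (hdeg : f.natDegree = 5)
    {D : Divisor f K} (hD : D ∈ degZero f K) :
    ∃ P Q : Point f K, toClass f K D = ptClass P + ptClass Q := by
  -- Subtracting the degree at infinity allows induction over all divisors, since single points do
  -- not have degree zero.
  have hsum : ∀ D : Divisor f K, ∃ P Q : Point f K,
      toClass f K (D - Finsupp.single .infinity (D.sum fun _ n => n)) = ptClass P + ptClass Q := by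
    have step (P : Point f K) (n : ℕ) : ∀ Q R : Point f K, ∃ Q' R' : Point f K,
        ptClass Q + ptClass R + n • ptClass P = ptClass Q' + ptClass R' := by
      induction n with
      | zero => exact fun Q R => ⟨Q, R, by simp⟩
      | succ n ih =>
        intro Q R
        obtain ⟨Q', R', h⟩ := ih Q R
        obtain ⟨Q'', R'', h'⟩ := exists_add_eq_of_three H hdeg Q' R' P
        exact ⟨Q'', R'', by rw [← h', ← h, succ_nsmul]; abel⟩
    intro D
    induction D using Finsupp.induction_linear with
    | zero => exact ⟨.infinity, .infinity, by simp⟩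
    | add D D' h h' =>
      obtain ⟨P, Q, h⟩ := h
      obtain ⟨P', Q', h'⟩ := h'
      obtain ⟨P₁, Q₁, h₁⟩ := step P' 1 P Q
      obtain ⟨P₂, Q₂, h₂⟩ := step Q' 1 P₁ Q₁
      refine ⟨P₂, Q₂, ?_⟩
      rw [← h₂, ← h₁, one_smul, one_smul, add_assoc _ (ptClass P'), ← h, ← h', ← map_add,
        Finsupp.sum_add_index' (by simp) (by simp), Finsupp.single_add]
      congr 1
      abel
    | single P n =>
      have key (n : ℤ) : toClass f K (Finsupp.single P n - Finsupp.single .infinity n) =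
          n • ptClass P := by
        rw [ptClass, ← map_zsmul, smul_sub, Finsupp.smul_single, Finsupp.smul_single]
        simp
      rw [Finsupp.sum_single_index rfl, key]
      obtain ⟨m, rfl | rfl⟩ := n.eq_nat_or_neg
      · obtain ⟨Q, R, h⟩ := step P m .infinity .infinity
        exact ⟨Q, R, by simpa using h⟩
      -- Negative multiples of `P` are positive multiples of `w(P)`.
      · obtain ⟨Q, R, h⟩ := step P.w m .infinity .infinity
        exact ⟨Q, R, by simpa [ptClass_w H] using h⟩
  have h0 : D.sum (fun _ n => n) = 0 := hD
  simpa [h0] using hsum D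

theorem isSemiReducedWith_zero {D : Divisor f K} : IsSemiReducedWith 0 D ↔ D = 0 := by
  constructor
  · rintro ⟨P, -, -, rfl⟩
    simp
  · rintro rfl
    exact ⟨Fin.elim0, fun i => i.elim0, fun i => i.elim0, by simp⟩

theorem isSemiReducedWith_one {D : Divisor f K} : IsSemiReducedWith 1 D ↔
    ∃ P, P ≠ .infinity ∧ D = Finsupp.single P 1 - Finsupp.single .infinity 1 := by
  constructor
  · rintro ⟨P, h, -, rfl⟩
    exact ⟨P 0, h 0, by simp⟩
  · rintro ⟨P, hP, rfl⟩
    exact ⟨fun _ => P, fun _ => hP, fun i j h => (h (Subsingleton.elim _ _)).elim, by simp⟩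

theorem isSemiReducedWith_two {D : Divisor f K} : IsSemiReducedWith 2 D ↔
    ∃ P Q, P ≠ .infinity ∧ Q ≠ .infinity ∧ P ≠ Q.w ∧ D = pairDiv P Q := by
  constructor
  · rintro ⟨P, h, h', rfl⟩
    exact ⟨P 0, P 1, h 0, h 1, h' 0 1 (by simp), by simp [pairDiv]⟩
  · rintro ⟨P, Q, hP, hQ, hPQ, rfl⟩
    refine ⟨![P, Q], ?_, ?_, by simp [pairDiv]⟩
    · intro i; fin_cases i <;> assumption
    · have : Q ≠ P.w := fun h => hPQ (Point.w_eq_iff.1 h.symm)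
      intro i j hij
      fin_cases i <;> fin_cases j <;> first | exact (hij rfl).elim | assumption

/-- Every class of degree zero is represented by a reduced divisor. -/
theorem exists_isReduced [IsAlgClosed K] (H : IsOddCurve f K) (hdeg : f.natDegree = 5)
    {D : Divisor f K} (hD : D ∈ degZero f K) :
    ∃ D', IsReduced 2 D' ∧ toClass f K D' = toClass f K D := by
  obtain ⟨P, Q, h⟩ := exists_ptClass_add_ptClass H hdeg hD
  by_cases hPQ : P = Q.w
  · refine ⟨0, ⟨0, by omega, isSemiReducedWith_zero.2 rfl⟩, ?_⟩
    rw [h, hPQ, ptClass_w H]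
    simp
  by_cases hP : P = .infinity
  · subst hP
    have hQ : Q ≠ .infinity := by rintro rfl; exact hPQ rfl
    refine ⟨_, ⟨1, by omega, isSemiReducedWith_one.2 ⟨Q, hQ, rfl⟩⟩, ?_⟩
    rw [h, ptClass_infinity, zero_add]
    rfl
  by_cases hQ : Q = .infinity
  · subst hQ
    refine ⟨_, ⟨1, by omega, isSemiReducedWith_one.2 ⟨P, hP, rfl⟩⟩, ?_⟩
    rw [h, ptClass_infinity, add_zero]
    rfl
  · exact ⟨_, ⟨2, le_rfl, isSemiReducedWith_two.2 ⟨P, Q, hP, hQ, hPQ, rfl⟩⟩,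
      by rw [h, toClass_pairDiv]⟩

end Classes

/-! ### Semi-reduced divisors and uniqueness of reduced representatives. -/

section Uniqueness

variable {F : Type*} [Field F] {f : F[X]} {K : Type*} [Field K] [Algebra F K]

theorem Point.affine_w_eq_self (H : IsOddCurve f K) {x y : K} (e : y ^ 2 = aeval x f) :
    (Point.affine x y e : Point f K).w = .affine x y e ↔ y = 0 := by
  simp only [Point.w, Point.affine.injEq, true_and]
  constructor
  · intro h
    have : 2 * y = 0 := by linear_combination -h
    simpa [H.two_ne_zero] using this
  · rintro rfl; simp

theorem ord_poly_w (H : IsOddCurve f K) {a : K[X]} (ha : a ≠ 0) (P : Point f K) :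
    P.w.ord a 0 = P.ord a 0 := by
  cases P with
  | infinity => rfl
  | affine x y e =>
    rw [Point.w, ord_poly H ha, ord_poly H ha]
    by_cases hy : y = 0 <;> simp [hy]

theorem even_ord_poly (H : IsOddCurve f K) {a : K[X]} (ha : a ≠ 0) {P : Point f K} (hP : P.w = P) :
    Even (P.ord a 0) := by
  cases P with
  | infinity => simp [Point.ord]
  | affine x y e =>
    rw [Point.affine_w_eq_self H] at hP
    rw [ord_poly H ha, if_pos hP]
    exact even_two.mul_left _

theorem sum_single_sub_apply [DecidableEq (Point f K)] {r : ℕ} (P : Fin r → Point f K) (n : ℤ)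
    {Q : Point f K} (hQ : Q ≠ .infinity) :
    (∑ i, Finsupp.single (P i) 1 - Finsupp.single .infinity n : Divisor f K) Q =
      (Finset.univ.filter fun i => P i = Q).card := by
  simp only [Finsupp.coe_sub, Pi.sub_apply, Finsupp.finsetSum_apply, Finsupp.single_apply,
    if_neg hQ.symm, sub_zero, Finset.card_filter]
  push_cast
  rfl

theorem sum_single_sub_infinity {r : ℕ} {P : Fin r → Point f K} (hP : ∀ i, P i ≠ .infinity) :
    (∑ i, Finsupp.single (P i) 1 - Finsupp.single .infinity (r : ℤ) : Divisor f K) .infinity =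
      -(r : ℤ) := by
  simp [hP]

namespace IsSemiReducedWith

variable {r : ℕ} {D : Divisor f K}

theorem apply_infinity (h : IsSemiReducedWith r D) : D .infinity = -(r : ℤ) := by
  obtain ⟨P, hP, -, rfl⟩ := h
  exact sum_single_sub_infinity hP

theorem apply_nonneg (h : IsSemiReducedWith r D) {Q : Point f K} (hQ : Q ≠ .infinity) : 0 ≤ D Q := by
  classical
  obtain ⟨P, hP, -, rfl⟩ := h
  rw [sum_single_sub_apply P _ hQ]
  positivity

theorem apply_eq_zero_or (h : IsSemiReducedWith r D) {Q : Point f K} (hQ : Q ≠ .infinity)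
    (hw : Q.w ≠ Q) : D Q = 0 ∨ D Q.w = 0 := by
  classical
  obtain ⟨P, hP, h', rfl⟩ := h
  have hQ' : Q.w ≠ .infinity := by simpa using hQ
  rw [sum_single_sub_apply P _ hQ, sum_single_sub_apply P _ hQ']
  by_contra! hne
  simp only [ne_eq, Nat.cast_eq_zero, Finset.card_eq_zero, Finset.filter_eq_empty_iff,
    Finset.mem_univ, true_implies, not_forall, not_not] at hne
  obtain ⟨⟨i, hi⟩, j, hj⟩ := hne
  refine h' j i ?_ (by rw [hj, hi])
  rintro rfl
  exact hw (hj.symm.trans hi)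

theorem apply_le_one (h : IsSemiReducedWith r D) {Q : Point f K} (hQ : Q ≠ .infinity)
    (hw : Q.w = Q) : D Q ≤ 1 := by
  classical
  obtain ⟨P, hP, h', rfl⟩ := h
  rw [sum_single_sub_apply P _ hQ]
  norm_cast
  rw [Finset.card_le_one]
  intro i hi j hj
  simp only [Finset.mem_filter_univ] at hi hj
  by_contra hij
  exact h' i j hij (by rw [hi, hj, hw])

theorem mem_degZero (h : IsSemiReducedWith r D) : D ∈ degZero f K := by
  obtain ⟨P, -, -, rfl⟩ := h
  simp [degZero, AddMonoidHom.mem_ker, map_sub, map_sum]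

/-- A nonempty semi-reduced divisor is not the divisor of a polynomial in `x`. -/
theorem not_isDivOf_poly (H : IsOddCurve f K) (h : IsSemiReducedWith r D) (hr : r ≠ 0)
    (a : K[X]) : ¬ IsDivOf a 0 D := by
  classical
  rintro ⟨ha, hD⟩
  have ha : a ≠ 0 := by simpa using ha
  have hpos : ∃ Q : Point f K, Q ≠ .infinity ∧ 1 ≤ D Q := by
    obtain ⟨P, hP, h', rfl⟩ := h
    refine ⟨P ⟨0, Nat.pos_of_ne_zero hr⟩, hP _, ?_⟩
    rw [sum_single_sub_apply P _ (hP _)]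
    norm_cast
    exact Finset.card_pos.2 ⟨⟨0, Nat.pos_of_ne_zero hr⟩, by simp⟩
  obtain ⟨Q, hQ, h1⟩ := hpos
  -- A polynomial in `x` has the same order at opposite points, which semi-reducedness only permits
  -- at Weierstrass points; there the order 1 is not even.
  have hsymm : D Q.w = D Q := by rw [hD, hD, ord_poly_w H ha]
  by_cases hw : Q.w = Q
  · have := h.apply_le_one hQ hw
    have he := even_ord_poly H ha hw
    rw [← hD, show D Q = 1 by omega] at he
    exact absurd he (by decide)
  · rcases h.apply_eq_zero_or hQ hw with h0 | h0 <;> omega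

end IsSemiReducedWith

theorem isDivOf_poly_of_neg_le (H : IsOddCurve f K) {a b : K[X]} {D : Divisor f K}
    (h : IsDivOf a b D) (hlt : -(f.natDegree : ℤ) < D .infinity) : b = 0 := by
  by_contra hb
  rw [h.2, ord_infinity H h.1, (polyNorm_aux H h.1).2, if_neg hb] at hlt
  have := le_max_right (2 * a.natDegree) (f.natDegree + 2 * b.natDegree)
  omega

theorem eq_of_apply_eq {D D' : Divisor f K} (hD : D ∈ degZero f K) (hD' : D' ∈ degZero f K)
    (h : ∀ P, P ≠ .infinity → D P = D' P) : D = D' := by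
  have hs : D - D' = Finsupp.single .infinity ((D - D') .infinity) := by
    ext P
    by_cases hP : P = .infinity
    · simp [hP]
    · simp [Ne.symm hP, h P hP]
  have hz : D - D' ∈ degZero f K := sub_mem hD hD'
  generalize (D - D') .infinity = k at hs
  rw [hs] at hz
  have : k = 0 := by simpa [degZero, AddMonoidHom.mem_ker] using hz
  rw [this, Finsupp.single_zero] at hs
  exact sub_eq_zero.1 hs

theorem mapDomain_sum_single_sub (g : Point f K → Point f K) {r : ℕ} (P : Fin r → Point f K)
    (n : ℤ) : (∑ i, Finsupp.single (P i) 1 - Finsupp.single .infinity n : Divisor f K).mapDomain g =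
      ∑ i, Finsupp.single (g (P i)) 1 - Finsupp.single (g .infinity) n := by
  change Finsupp.mapDomain.addMonoidHom g _ = _
  rw [map_sub, map_sum]
  simp [Finsupp.mapDomain.addMonoidHom]

/-- Linearly equivalent reduced divisors are equal. -/
theorem IsReduced.eq_of_toClass_eq [IsAlgClosed K] (H : IsOddCurve f K) {g : ℕ}
    (hdeg : f.natDegree = 2 * g + 1) {D D' : Divisor f K} (hD : IsReduced g D)
    (hD' : IsReduced g D') (h : toClass f K D = toClass f K D') : D = D' := by
  classical
  obtain ⟨r, hr, hD⟩ := hD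
  obtain ⟨s, hs, hD'⟩ := hD'
  -- `D + w(D')` is equivalent to `D - D'` but has no affine poles; its pole order at most `2g` is
  -- below `deg f`, so it is the divisor of a polynomial in `x`.
  set D'w : Divisor f K := D'.mapDomain Point.w with hw_def
  have happ (Q : Point f K) : D'w Q = D' Q.w := by
    conv_lhs => rw [← Q.w_w]
    exact Finsupp.mapDomain_apply Point.w_injective _ _
  have hcls : toClass f K D'w = -toClass f K D' := by
    obtain ⟨Q, -, -, hQ⟩ := hD'
    rw [hw_def, hQ, toClass_sum, mapDomain_sum_single_sub, Point.w, toClass_sum,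
      ← Finset.sum_neg_distrib]
    exact Finset.sum_congr rfl fun i _ => ptClass_w H _
  obtain ⟨a, b, hE⟩ := exists_isDivOf H (D := D + D'w) (fun P hP => by
    rw [Finsupp.add_apply, happ]
    exact add_nonneg (hD.apply_nonneg hP) (hD'.apply_nonneg (by simpa using hP))) (by
    rw [← toClass_eq_zero, map_add, h, hcls, add_neg_cancel])
  have hb : b = 0 := isDivOf_poly_of_neg_le H hE (by
    rw [Finsupp.add_apply, happ, Point.w, hD.apply_infinity, hD'.apply_infinity]
    omega)
  subst hb
  have ha : a ≠ 0 := by simpa using hE.1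
  refine eq_of_apply_eq hD.mem_degZero hD'.mem_degZero fun P hP => ?_
  have hPw : P.w ≠ .infinity := by simpa using hP
  have h1 := hE.2 P
  have h2 := hE.2 P.w
  rw [ord_poly_w H ha] at h2
  rw [Finsupp.add_apply, happ] at h1 h2
  rw [Point.w_w] at h2
  have n1 := hD.apply_nonneg hP
  have n2 := hD.apply_nonneg hPw
  have n3 := hD'.apply_nonneg hP
  have n4 := hD'.apply_nonneg hPw
  by_cases hw : P.w = P
  · have h3 := hD.apply_le_one hP hw
    have h4 := hD'.apply_le_one hP hw
    have h5 := even_ord_poly H ha hw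
    rw [hw] at h1
    rw [← h1] at h5
    obtain ⟨k, hk⟩ := h5
    omega
  -- By `w`-invariance `D(P) + D'(wP) = D(wP) + D'(P)`, and each divisor vanishes at `P` or at
  -- `w(P)`.
  · have h3 := hD.apply_eq_zero_or hP hw
    have h4 := hD'.apply_eq_zero_or hP hw
    omega

theorem IsDivOf.C_mul (H : IsOddCurve f K) {a b : K[X]} {D : Divisor f K} (h : IsDivOf a b D)
    {k : K} (hk : k ≠ 0) : IsDivOf (C k * a) (C k * b) D := by
  have hk' : C k ≠ 0 := by simpa using hk
  refine ⟨h.1.imp (mul_ne_zero hk') (mul_ne_zero hk'), fun P => ?_⟩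
  rw [ord_poly_mul_polyFun H hk' h.1, ord_C H hk, zero_add, h.2]

end Uniqueness

/-! ### Galois action on points, functions and principal divisors. -/

section Galois

variable {F : Type*} [Field F] {f : F[X]} {K : Type*} [Field K] [Algebra F K]

/-- The action of an automorphism of `K` on the points. -/
def Point.galMap (σ : K ≃ₐ[F] K) : Point f K → Point f K
  | .infinity => .infinity
  | .affine x y h => .affine (σ x) (σ y) (by rw [← map_pow, h, aeval_algHom_apply])

theorem Point.galMap_symm_galMap (σ : K ≃ₐ[F] K) (P : Point f K) :
    (P.galMap σ.symm).galMap σ = P := by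
  cases P <;> simp [Point.galMap]

theorem Point.galMap_injective (σ : K ≃ₐ[F] K) :
    Function.Injective (Point.galMap σ : Point f K → Point f K) := by
  intro P Q h
  have := congrArg (Point.galMap σ.symm) h
  have hs (R : Point f K) := Point.galMap_symm_galMap σ.symm R
  simp only [AlgEquiv.symm_symm] at hs
  rwa [hs, hs] at this

theorem map_algebraMap_galois (σ : K ≃ₐ[F] K) (p : F[X]) :
    (p.map (algebraMap F K)).map (σ : K →+* K) = p.map (algebraMap F K) := by
  rw [Polynomial.map_map]
  congr 1
  ext x
  simp

variable (f) in
/-- The action of an automorphism of `K` on the coordinate ring. -/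
noncomputable def galHom (σ : K ≃ₐ[F] K) : CoordRing f K →+* CoordRing f K :=
  AdjoinRoot.lift ((AdjoinRoot.of _).comp (mapRingHom (σ : K →+* K))) (AdjoinRoot.root _) (by
    rw [eval₂_sub, eval₂_X_pow, eval₂_C, RingHom.comp_apply, coe_mapRingHom,
      map_algebraMap_galois, sub_eq_zero]
    exact (pow_two _).trans root_mul_root)

theorem galHom_polyFun (σ : K ≃ₐ[F] K) (a b : K[X]) :
    galHom f σ (polyFun a b) = polyFun (a.map (σ : K →+* K)) (b.map (σ : K →+* K)) := by
  simp [galHom, polyFun]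

theorem galHom_mem_pow (σ : K ≃ₐ[F] K) {x y : K} {n : ℕ} {g : CoordRing f K}
    (h : g ∈ Point.pointIdeal x y ^ n) : galHom f σ g ∈ Point.pointIdeal (σ x) (σ y) ^ n := by
  have h1 := Ideal.mem_map_of_mem (galHom f σ) h
  rw [Ideal.map_pow] at h1
  refine Ideal.pow_right_mono ?_ n h1
  rw [Point.pointIdeal, Ideal.map_span, Ideal.span_le]
  rintro _ ⟨z, rfl | rfl, rfl⟩
  · apply Ideal.subset_span
    left
    simp [galHom]
  · apply Ideal.subset_span
    right
    simp [galHom]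

theorem ord_galMap (σ : K ≃ₐ[F] K) (a b : K[X]) (P : Point f K) :
    (P.galMap σ).ord (a.map (σ : K →+* K)) (b.map (σ : K →+* K)) = P.ord a b := by
  classical
  cases P with
  | infinity =>
    have hb : b.map (σ : K →+* K) = 0 ↔ b = 0 := Polynomial.map_eq_zero _
    simp only [Point.galMap, Point.ord, natDegree_map, hb]
  | affine x y e =>
    simp only [Point.galMap, Point.ord]
    congr 3
    ext n
    constructor
    · intro h
      have := galHom_mem_pow σ.symm h
      rw [galHom_polyFun, Polynomial.map_map, Polynomial.map_map] at this
      have hid : ((σ.symm : K →+* K)).comp (σ : K →+* K) = RingHom.id K := by ext; simp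
      simpa [hid] using this
    · intro h
      have := galHom_mem_pow σ h
      rwa [galHom_polyFun] at this

theorem IsDivOf.galMap (σ : K ≃ₐ[F] K) {a b : K[X]} {D : Divisor f K} (h : IsDivOf a b D) :
    IsDivOf (a.map (σ : K →+* K)) (b.map (σ : K →+* K))
      (Finsupp.mapDomain (Point.galMap σ) D) := by
  refine ⟨h.1.imp ?_ ?_, fun P => ?_⟩
  · exact (Polynomial.map_ne_zero_iff σ.injective).2
  · exact (Polynomial.map_ne_zero_iff σ.injective).2
  · rw [← Point.galMap_symm_galMap σ P, Finsupp.mapDomain_apply (Point.galMap_injective σ),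
      ord_galMap, h.2]

theorem mapDomain_galMap_mem_principal (σ : K ≃ₐ[F] K) {D : Divisor f K}
    (hD : D ∈ principal f K) : Finsupp.mapDomain (Point.galMap σ) D ∈ principal f K := by
  have : principal f K ≤
      (principal f K).comap (Finsupp.mapDomain.addMonoidHom (Point.galMap σ)) := by
    rw [principal, AddSubgroup.closure_le]
    rintro D ⟨a, b, h⟩
    exact (h.galMap σ).mem_principal
  exact this hD

end Galois

/-! ### The Frobenius automorphism and descent of functions to `F`. -/

section Frobenius

variable {F : Type*} [Field F] [Fintype F] {f : F[X]} {K : Type*} [Field K] [Algebra F K]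

/-- The elements of `F` already exhaust the at most `q` roots of `X^q - X`. -/
theorem mem_range_algebraMap_of_pow_card {x : K} (h : x ^ Fintype.card F = x) :
    x ∈ Set.range (algebraMap F K) := by
  classical
  have h0 : (X ^ Fintype.card F - X : K[X]) ≠ 0 :=
    FiniteField.X_pow_card_sub_X_ne_zero K Fintype.one_lt_card
  have hsub : Finset.univ.image (algebraMap F K) ⊆ (X ^ Fintype.card F - X : K[X]).roots.toFinset := by
    intro y hy
    obtain ⟨z, -, rfl⟩ := Finset.mem_image.1 hy
    rw [Multiset.mem_toFinset, mem_roots h0]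
    simp [← map_pow, FiniteField.pow_card]
  have heq := Finset.eq_of_subset_of_card_le hsub (by
    rw [Finset.card_image_of_injective _ (algebraMap F K).injective, Finset.card_univ]
    refine (Multiset.toFinset_card_le _).trans ((card_roots' _).trans ?_)
    rw [FiniteField.X_pow_card_sub_X_natDegree_eq K Fintype.one_lt_card])
  have hx : x ∈ (X ^ Fintype.card F - X : K[X]).roots.toFinset := by
    rw [Multiset.mem_toFinset, mem_roots h0]
    simp [h]
  rw [← heq] at hx
  obtain ⟨z, -, rfl⟩ := Finset.mem_image.1 hx
  exact ⟨z, rfl⟩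

theorem Point.frob_w (P : Point f K) : P.w.frob = P.frob.w := by
  cases P with
  | infinity => rfl
  | affine x y e =>
    simp only [Point.w, Point.frob, Point.affine.injEq, true_and]
    exact (map_neg (FiniteField.frobeniusAlgHom F K) y)

@[simp]
theorem Point.frob_eq_infinity {P : Point f K} : P.frob = .infinity ↔ P = .infinity := by
  cases P <;> simp [Point.frob]

variable [Algebra.IsAlgebraic F K]

variable (F K) in
/-- The Frobenius automorphism of `K` over `F`. -/
noncomputable abbrev frobEquiv : K ≃ₐ[F] K := FiniteField.frobeniusAlgEquivOfAlgebraic F K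

theorem exists_map_eq_of_frob {a : K[X]} (h : a.map (frobEquiv F K : K →+* K) = a) :
    ∃ a₀ : F[X], a₀.map (algebraMap F K) = a := by
  rw [← mem_lifts, lifts_iff_coeff_lifts]
  intro n
  apply mem_range_algebraMap_of_pow_card
  have := congrArg (coeff · n) h
  simpa [coeff_map] using this

theorem frob_eq_galMap : (Point.frob : Point f K → Point f K) = Point.galMap (frobEquiv F K) := by
  funext P
  cases P <;> rfl

theorem Point.frob_injective : Function.Injective (Point.frob : Point f K → Point f K) := by
  rw [frob_eq_galMap]
  exact Point.galMap_injective _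

theorem frobDiv_mem_principal {D : Divisor f K} (hD : D ∈ principal f K) :
    frobDiv f K D ∈ principal f K := by
  have := mapDomain_galMap_mem_principal (frobEquiv F K) hD
  rwa [← frob_eq_galMap] at this

/-- If the divisor of a polynomial function is stable under Frobenius, then the function can be
scaled to have coefficients in `F`. -/
theorem IsDivOf.exists_descent [IsAlgClosed K] (H : IsOddCurve f K) {a b : K[X]} {D : Divisor f K}
    (h : IsDivOf a b D) (ha : a ≠ 0) (hD : frobDiv f K D = D) :
    ∃ h₁ h₂ : F[X], IsDivOf (h₁.map (algebraMap F K)) (h₂.map (algebraMap F K)) D := by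
  have h' := h.C_mul H (inv_ne_zero (leadingCoeff_ne_zero.2 ha))
  set a' := C a.leadingCoeff⁻¹ * a
  set b' := C a.leadingCoeff⁻¹ * b
  have hm : a'.Monic := by
    rw [Monic, leadingCoeff_mul, leadingCoeff_C, inv_mul_cancel₀ (leadingCoeff_ne_zero.2 ha)]
  have h'' := h'.galMap (frobEquiv F K)
  rw [← frob_eq_galMap, show Finsupp.mapDomain Point.frob D = D from hD] at h''
  obtain ⟨k, hka, hkb⟩ := h'.exists_C_mul H h''
  -- Frobenius changes the function by a constant, and it keeps `a'` monic.
  have hk : k = 1 := by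
    have h1 := congrArg leadingCoeff hka
    rw [leadingCoeff_mul, leadingCoeff_C, hm.leadingCoeff, (hm.map _).leadingCoeff] at h1
    simpa using h1.symm
  rw [hk, map_one, one_mul] at hka hkb
  obtain ⟨h₁, e₁⟩ := exists_map_eq_of_frob hka
  obtain ⟨h₂, e₂⟩ := exists_map_eq_of_frob hkb
  exact ⟨h₁, h₂, by rwa [e₁, e₂]⟩

end Frobenius

/-! ### Mumford representations of pairs, and parity of small pole orders. -/

section Mumford

variable {F : Type*} [Field F] {f : F[X]} {K : Type*} [Field K] [Algebra F K]

theorem isSemiReducedWith_of_lt {r : ℕ} {P : Fin r → Point f K} (hP : ∀ i, P i ≠ .infinity)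
    (h : ∀ i j, i < j → P i ≠ (P j).w) :
    IsSemiReducedWith r (∑ i, Finsupp.single (P i) 1 - Finsupp.single .infinity (r : ℤ)) := by
  refine ⟨P, hP, fun i j hij => ?_, rfl⟩
  rcases lt_or_gt_of_ne hij with h' | h'
  · exact h i j h'
  · exact fun e => h j i h' (Point.w_eq_iff.1 e.symm)

theorem exists_isMumford_pairDiv {P Q : Point f K} (hP : P ≠ .infinity) (hQ : Q ≠ .infinity)
    (hne : P ≠ Q) (hw : P ≠ Q.w) :
    ∃ u v : K[X], IsMumford (pairDiv P Q) u v ∧ u.natDegree = 2 := by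
  classical
  rcases P with _ | ⟨x₁, y₁, e₁⟩
  · exact (hP rfl).elim
  rcases Q with _ | ⟨x₂, y₂, e₂⟩
  · exact (hQ rfl).elim
  -- Points with equal `x` are equal or opposite. So the line through both points serves as `v`, and
  -- the two factors of `u` are coprime.
  have hx : x₁ ≠ x₂ := by
    rintro rfl
    simp only [Point.w, ne_eq, Point.affine.injEq, true_and] at hne hw
    exact (sq_eq_sq_iff_eq_or_eq_neg.1 (e₁.trans e₂.symm)).elim hne hw
  have hx' : x₂ - x₁ ≠ 0 := sub_ne_zero.2 hx.symm
  have hdeg : ((X - C x₁) * (X - C x₂)).natDegree = 2 := by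
    rw [natDegree_mul (X_sub_C_ne_zero _) (X_sub_C_ne_zero _), natDegree_X_sub_C,
      natDegree_X_sub_C]
  set v : K[X] := C ((y₂ - y₁) / (x₂ - x₁)) * (X - C x₁) + C y₁ with hv
  have hv₁ : v.eval x₁ = y₁ := by simp [hv]
  have hv₂ : v.eval x₂ = y₂ := by
    simp only [hv, eval_add, eval_mul, eval_C, eval_sub, eval_X]
    field_simp
    ring
  have hroot {r y : K} (e : y ^ 2 = aeval r f) (h : v.eval r = y) :
      X - C r ∣ v ^ 2 - f.map (algebraMap F K) := by
    rw [dvd_iff_isRoot]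
    simp [h, e]
  refine ⟨(X - C x₁) * (X - C x₂), v, ⟨?_, ?_, ?_, ?_⟩, hdeg⟩
  · rw [Finsupp.prod_of_support_subset (s := {.affine x₁ y₁ e₁, .affine x₂ y₂ e₂, .infinity}),
      Finset.prod_insert, Finset.prod_insert, Finset.prod_singleton]
    · have hne' : ¬ (x₁ = x₂ ∧ y₁ = y₂) := fun h => hx h.1
      have hne'' : ¬ (x₂ = x₁ ∧ y₂ = y₁) := fun h => hx h.1.symm
      simp [uFactor, pairDiv, hne', hne'']
    · simp
    · simp [hx]
    · intro R hR
      by_contra hmem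
      simp only [Finset.mem_insert, Finset.mem_singleton, not_or] at hmem
      rw [Finsupp.mem_support_iff] at hR
      apply hR
      simp [pairDiv, Ne.symm hmem.1, Ne.symm hmem.2.1, Ne.symm hmem.2.2]
    · rintro (_ | ⟨x, y, e⟩) - <;> simp [uFactor]
  · rw [degree_eq_natDegree (p := (X - C x₁) * (X - C x₂))
      (fun h0 => by rw [h0] at hdeg; simp at hdeg), hdeg]
    refine lt_of_le_of_lt degree_le_natDegree ?_
    have : v.natDegree ≤ 1 := by rw [hv]; compute_degree
    exact_mod_cast Nat.lt_succ_of_le this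
  · intro x y h hD
    have : (x₁ = x ∧ y₁ = y) ∨ (x₂ = x ∧ y₂ = y) := by
      by_contra! hcon
      apply hD
      have h1 : ¬ (x₁ = x ∧ y₁ = y) := fun h => hcon.1 h.1 h.2
      have h2 : ¬ (x₂ = x ∧ y₂ = y) := fun h => hcon.2 h.1 h.2
      simp [pairDiv, h1, h2]
    rcases this with ⟨rfl, rfl⟩ | ⟨rfl, rfl⟩ <;> assumption
  · exact (isCoprime_X_sub_C_of_isUnit_sub (sub_ne_zero.2 hx).isUnit).mul_dvd
      (hroot e₁ hv₁) (hroot e₂ hv₂)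

theorem pairDiv_inj {P Q P' Q' : Point f K} (h : pairDiv P Q = pairDiv P' Q') :
    (P = P' ∧ Q = Q') ∨ (P = Q' ∧ Q = P') := by
  rw [pairDiv, pairDiv, sub_left_inj,
    Finsupp.single_add_single_eq_single_add_single one_ne_zero one_ne_zero] at h
  simpa using h

/-- The order at infinity of a nonzero polynomial function of small pole order is even. -/
theorem even_apply_infinity [IsAlgClosed K] (H : IsOddCurve f K) {D : Divisor f K}
    (hD : ∀ P, P ≠ .infinity → 0 ≤ D P) (hp : D ∈ principal f K)
    (hlt : -(f.natDegree : ℤ) < D .infinity) : Even (D .infinity) := by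
  obtain ⟨a, b, h⟩ := exists_isDivOf H hD hp
  have hb := isDivOf_poly_of_neg_le H h hlt
  rw [h.2, ord_infinity H h.1, (polyNorm_aux H h.1).2, if_pos hb]
  simp

theorem single_sub_single_notMem [IsAlgClosed K] (H : IsOddCurve f K)
    (hdeg : 5 ≤ f.natDegree) {P : Point f K} (hP : P ≠ .infinity) :
    (Finsupp.single P 1 - Finsupp.single .infinity 1 : Divisor f K) ∉ principal f K := by
  intro h
  have hinf : (Finsupp.single P 1 - Finsupp.single .infinity 1 : Divisor f K) .infinity = -1 := by
    simp [hP]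
  have := even_apply_infinity H (fun Q hQ => by
    classical
    rw [Finsupp.sub_apply, Finsupp.single_apply, Finsupp.single_apply, if_neg hQ.symm]
    split_ifs <;> simp) h (by rw [hinf]; omega)
  rw [hinf] at this
  exact absurd this (by decide)

end Mumford

/-! ### Traces over the cubic extension and torsion in `Pic`. -/

section Trace

variable {F : Type*} [Field F] [Fintype F] {f : F[X]} {K : Type*} [Field K] [Algebra F K]

theorem frobPow_zero_apply (D : Divisor f K) : frobPow f K 0 D = D :=
  Finsupp.mapDomain_id

theorem frobPow_succ_apply (n : ℕ) (D : Divisor f K) :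
    frobPow f K (n + 1) D = frobDiv f K (frobPow f K n D) := by
  change Finsupp.mapDomain _ D = Finsupp.mapDomain _ (Finsupp.mapDomain _ D)
  rw [← Finsupp.mapDomain_comp, ← Function.iterate_succ']

theorem frobPow_three_apply (D : Divisor f K) :
    frobPow f K 3 D = frobDiv f K (frobDiv f K (frobDiv f K D)) := by
  simp only [frobPow_succ_apply, frobPow_zero_apply]

theorem trace_three_apply (D : Divisor f K) :
    trace f K 3 D = D + frobDiv f K D + frobDiv f K (frobDiv f K D) := by
  simp [trace, Finset.sum_range_succ, frobPow_succ_apply, frobPow_zero_apply]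

theorem mem_ratDivZero_three {D : Divisor f K} : D ∈ ratDivZero f K 3 ↔
    D ∈ degZero f K ∧ frobDiv f K (frobDiv f K (frobDiv f K D)) = D := by
  rw [← frobPow_three_apply]
  rfl

theorem frobDiv_single (P : Point f K) (n : ℤ) :
    frobDiv f K (Finsupp.single P n) = Finsupp.single P.frob n :=
  Finsupp.mapDomain_single

theorem frobDiv_pairDiv (P Q : Point f K) :
    frobDiv f K (pairDiv P Q) = pairDiv P.frob Q.frob := by
  simp only [pairDiv, map_sub, map_add, frobDiv_single]
  rfl

theorem frobDiv_mem_degZero {D : Divisor f K} (hD : D ∈ degZero f K) :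
    frobDiv f K D ∈ degZero f K := by
  have : (Finsupp.liftAddHom fun _ : Point f K => AddMonoidHom.id ℤ).comp (frobDiv f K) =
      Finsupp.liftAddHom fun _ : Point f K => AddMonoidHom.id ℤ := by
    ext P
    simp [frobDiv_single]
  rw [degZero, AddMonoidHom.mem_ker] at hD ⊢
  rw [← hD]
  exact DFunLike.congr_fun this D

theorem trace_three_mem_ratDivZero {D : Divisor f K} (h : D ∈ ratDivZero f K 3) :
    frobDiv f K (trace f K 3 D) = trace f K 3 D ∧ trace f K 3 D ∈ ratDivZero f K 3 := by
  obtain ⟨h0, h3⟩ := mem_ratDivZero_three.1 h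
  have h1 : frobDiv f K (trace f K 3 D) = trace f K 3 D := by
    rw [trace_three_apply, map_add, map_add, h3]
    abel
  refine ⟨h1, mem_ratDivZero_three.2 ⟨?_, by rw [h1, h1, h1]⟩⟩
  rw [trace_three_apply]
  exact add_mem (add_mem h0 (frobDiv_mem_degZero h0)) (frobDiv_mem_degZero (frobDiv_mem_degZero h0))

/-- The order of the class divides both `p` and the group order. An infinite group would have
`Nat.card` equal to 0, which `p` divides, so the hypothesis excludes it. -/
theorem mem_principal_of_smul_mem {n p : ℕ} (hp : p.Prime) (h : ¬ p ∣ Nat.card (picRat f K n))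
    {D : Divisor f K} (hD : D ∈ ratDivZero f K n) (hpD : p • D ∈ principal f K) :
    D ∈ principal f K := by
  let c : picRat f K n := ⟨toClass f K D, D, hD, rfl⟩
  have hc : p • c = 0 := by
    apply Subtype.ext
    change p • toClass f K D = 0
    rw [← map_nsmul, toClass_eq_zero]
    exact hpD
  have h1 := addOrderOf_dvd_of_nsmul_eq_zero hc
  have h2 := addOrderOf_dvd_natCard c
  have h3 : addOrderOf c = 1 := ((Nat.dvd_prime hp).1 h1).resolve_right fun e => h (e ▸ h2)
  rw [AddMonoid.addOrderOf_eq_one_iff] at h3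
  exact toClass_eq_zero.1 (congrArg Subtype.val h3)

theorem single_sub_single_mem_ratDivZero {P : Point f K} (h : P.frob.frob.frob = P) :
    (Finsupp.single P 1 - Finsupp.single .infinity 1 : Divisor f K) ∈ ratDivZero f K 3 := by
  refine mem_ratDivZero_three.2 ⟨?_, ?_⟩
  · rw [degZero, AddMonoidHom.mem_ker, map_sub]
    simp
  · simp only [map_sub, frobDiv_single, h]
    rfl

/-- The pole order is 3, odd and less than 5. -/
theorem trace_single_sub_single_notMem [IsAlgClosed K] (H : IsOddCurve f K)
    (hdeg : 5 ≤ f.natDegree) {P : Point f K} (hP : P ≠ .infinity) :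
    trace f K 3 (Finsupp.single P 1 - Finsupp.single .infinity 1) ∉ principal f K := by
  intro h
  have hval : trace f K 3 (Finsupp.single P 1 - Finsupp.single .infinity 1) =
      ∑ i, Finsupp.single ((![P, P.frob, P.frob.frob] : Fin 3 → Point f K) i) 1 -
        Finsupp.single .infinity ((3 : ℕ) : ℤ) := by
    rw [sum_single_sub_eq, Fin.sum_univ_three, trace_three_apply]
    simp only [map_sub, frobDiv_single]
    rfl
  have hinf := sum_single_sub_infinity (f := f) (P := ![P, P.frob, P.frob.frob]) (by
    intro i; fin_cases i <;> simp [hP])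
  rw [← hval] at hinf
  have := even_apply_infinity H (fun Q hQ => by
    classical
    rw [hval, sum_single_sub_apply _ _ hQ]
    positivity) h (by rw [hinf]; push_cast; omega)
  rw [hinf] at this
  exact absurd this (by decide)

/-- A rational affine Weierstrass point gives rise to `2`-torsion in `Pic`. -/
theorem Point.w_ne_self_of_rational [IsAlgClosed K] (H : IsOddCurve f K) (hdeg : 5 ≤ f.natDegree)
    (h2 : ¬ 2 ∣ Nat.card (picRat f K 3)) {P : Point f K} (hP : P ≠ .infinity)
    (h : P.frob.frob.frob = P) : P.w ≠ P := by
  intro hw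
  refine single_sub_single_notMem H hdeg hP
    (mem_principal_of_smul_mem Nat.prime_two h2 (single_sub_single_mem_ratDivZero h) ?_)
  rw [← toClass_eq_zero, map_nsmul, two_nsmul]
  change ptClass P + ptClass P = 0
  nth_rw 1 [← hw]
  rw [ptClass_w H, neg_add_cancel]

variable [Algebra.IsAlgebraic F K]

theorem IsSemiReducedWith.frobDiv {r : ℕ} {D : Divisor f K} (h : IsSemiReducedWith r D) :
    IsSemiReducedWith r (frobDiv f K D) := by
  obtain ⟨P, hP, h', rfl⟩ := h
  refine ⟨fun i => (P i).frob, fun i => by simpa using hP i, fun i j hij e => h' i j hij ?_, ?_⟩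
  · rw [← Point.frob_w] at e
    exact Point.frob_injective e
  · exact mapDomain_sum_single_sub _ _ _

theorem IsReduced.frobDiv {g : ℕ} {D : Divisor f K} (h : IsReduced g D) :
    IsReduced g (frobDiv f K D) := by
  obtain ⟨r, hr, h⟩ := h
  exact ⟨r, hr, h.frobDiv⟩

/-- A reduced divisor in a class that contains a rational divisor is rational. -/
theorem IsReduced.mem_ratDivZero [IsAlgClosed K] (H : IsOddCurve f K) {g : ℕ}
    (hdeg : f.natDegree = 2 * g + 1) {D D' : Divisor f K} (hD : IsReduced g D)
    (hD' : D' ∈ ratDivZero f K 3) (h : toClass f K D = toClass f K D') :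
    D ∈ ratDivZero f K 3 := by
  obtain ⟨-, h3⟩ := mem_ratDivZero_three.1 hD'
  refine mem_ratDivZero_three.2 ⟨?_, ?_⟩
  · obtain ⟨r, -, hr⟩ := hD
    exact hr.mem_degZero
  -- `φ³(D)` is again reduced and is equivalent to `φ³(D') = D'`, so uniqueness applies.
  · refine hD.frobDiv.frobDiv.frobDiv.eq_of_toClass_eq H hdeg hD ?_
    rw [toClass_eq_iff] at h ⊢
    have h1 := frobDiv_mem_principal (frobDiv_mem_principal (frobDiv_mem_principal h))
    rw [map_sub, map_sub, map_sub, h3] at h1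
    have := sub_mem h1 h
    convert this using 1
    abel

theorem trace_mem_principal {D : Divisor f K} (h : D ∈ principal f K) :
    trace f K 3 D ∈ principal f K := by
  rw [trace_three_apply]
  exact add_mem (add_mem h (frobDiv_mem_principal h))
    (frobDiv_mem_principal (frobDiv_mem_principal h))

end Trace

/-! ### The trace of a pair of points and its function. -/

section TraceZero

variable {F : Type*} [Field F] [Fintype F] {f : F[X]} {K : Type*} [Field K] [Algebra F K]

theorem trace_pairDiv (P Q : Point f K) : trace f K 3 (pairDiv P Q) =
    ∑ i, Finsupp.single ((![P, Q, P.frob, Q.frob, P.frob.frob, Q.frob.frob] :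
      Fin 6 → Point f K) i) 1 - Finsupp.single .infinity ((6 : ℕ) : ℤ) := by
  rw [sum_single_sub_eq, Fin.sum_univ_six, trace_three_apply, frobDiv_pairDiv, frobDiv_pairDiv,
    pairDiv_eq, pairDiv_eq, pairDiv_eq]
  simp only [Matrix.cons_val]
  abel

theorem trace_pairDiv_infinity {P Q : Point f K} (hP : P ≠ .infinity) (hQ : Q ≠ .infinity) :
    trace f K 3 (pairDiv P Q) .infinity = -6 := by
  rw [trace_pairDiv, sum_single_sub_infinity]
  · rfl
  · intro i; fin_cases i <;> simpa

/-- The pole order 6 equals `max (2 deg a) (5 + 2 deg b)` when `b ≠ 0`. The odd term cannot attain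
it and leaves no room for `deg b > 0`. -/
theorem natDegree_of_isDivOf_trace (H : IsOddCurve f K) (hdeg : f.natDegree = 5) {P Q : Point f K}
    (hP : P ≠ .infinity) (hQ : Q ≠ .infinity) {a b : K[X]}
    (h : IsDivOf a b (trace f K 3 (pairDiv P Q))) : a.natDegree = 3 ∧ b.natDegree = 0 := by
  have h6 := h.2 .infinity
  rw [trace_pairDiv_infinity hP hQ, ord_infinity H h.1, (polyNorm_aux H h.1).2, hdeg] at h6
  split_ifs at h6 with hb
  · subst hb
    exact ⟨by omega, natDegree_zero⟩
  · omega

variable [Algebra.IsAlgebraic F K]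

theorem exists_isDivOf_trace [IsAlgClosed K] (H : IsOddCurve f K) (hdeg : f.natDegree = 5)
    {P Q : Point f K} (hP : P ≠ .infinity) (hQ : Q ≠ .infinity)
    (hD : pairDiv P Q ∈ ratDivZero f K 3) (hT : trace f K 3 (pairDiv P Q) ∈ principal f K) :
    ∃ h₁ h₂ : F[X], IsDivOf (h₁.map (algebraMap F K)) (h₂.map (algebraMap F K))
      (trace f K 3 (pairDiv P Q)) := by
  obtain ⟨a, b, h⟩ := exists_isDivOf H (fun R hR => by
    classical
    rw [trace_pairDiv, sum_single_sub_apply _ _ hR]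
    positivity) hT
  refine h.exists_descent H ?_ (trace_three_mem_ratDivZero hD).1
  rintro rfl
  simpa using (natDegree_of_isDivOf_trace H hdeg hP hQ h).1

/-- If no point of `D = P + Q - 2𝒪` is opposite to a point of `D` or of `φ(D)`, then `D + φ(D)` and
the trace of `D` are semi-reduced. -/
theorem isSemiReducedWith_trace {P Q : Point f K} (hP : P ≠ .infinity) (hQ : Q ≠ .infinity)
    (hfrob : (P.frob.frob.frob = P ∧ Q.frob.frob.frob = Q) ∨
      (P.frob.frob.frob = Q ∧ Q.frob.frob.frob = P))
    (hPQ : P ≠ Q.w) (hPP : P ≠ P.frob.w) (hQQ : Q ≠ Q.frob.w) (hPfQ : P ≠ Q.frob.w)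
    (hQfP : Q ≠ P.frob.w) :
    IsSemiReducedWith 4 (pairDiv P Q + frobDiv f K (pairDiv P Q)) ∧
      IsSemiReducedWith 6 (trace f K 3 (pairDiv P Q)) := by
  have hf {R S : Point f K} (h : R ≠ S.w) : R.frob ≠ S.frob.w := by
    rw [← Point.frob_w]
    exact fun e => h (Point.frob_injective e)
  have hs {R S : Point f K} (h : R ≠ S.w) : S ≠ R.w := fun e => h (Point.w_eq_iff.1 e.symm)
  -- Applying `φ` to `R = w(φ²(S))` gives `φ(R) = w(φ³(S))`, and `φ³(S)` is again `P` or `Q`; so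
  -- relations with `φ²` reduce to relations with `φ`.
  have hb {R S : Point f K} (h : S.frob.frob.frob ≠ R.frob.w) : R ≠ S.frob.frob.w := fun e => by
    apply hs h
    rw [← Point.frob_w, e, Point.frob_w]
  have h1 : P ≠ P.frob.frob.w := hb (by rcases hfrob with h | h <;> simp only [h.1] <;> assumption)
  have h2 : Q ≠ Q.frob.frob.w := hb (by rcases hfrob with h | h <;> simp only [h.2] <;> assumption)
  have h3 : P ≠ Q.frob.frob.w := hb (by rcases hfrob with h | h <;> simp only [h.2] <;> assumption)
  have h4 : Q ≠ P.frob.frob.w := hb (by rcases hfrob with h | h <;> simp only [h.1] <;> assumption)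
  have h5 := hs (hf hQfP)
  constructor
  · have : pairDiv P Q + frobDiv f K (pairDiv P Q) = ∑ i, Finsupp.single
        ((![P, Q, P.frob, Q.frob] : Fin 4 → Point f K) i) 1 -
          Finsupp.single .infinity ((4 : ℕ) : ℤ) := by
      rw [sum_single_sub_eq, Fin.sum_univ_four, frobDiv_pairDiv, pairDiv_eq, pairDiv_eq]
      simp only [Matrix.cons_val]
      abel
    rw [this]
    refine isSemiReducedWith_of_lt (fun i => by fin_cases i <;> simpa) fun i j hij => ?_
    fin_cases i <;> fin_cases j <;>
      first
      | exact absurd hij (by decide)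
      | assumption
      | exact hf ‹_›
  · rw [trace_pairDiv]
    refine isSemiReducedWith_of_lt (fun i => by fin_cases i <;> simpa) fun i j hij => ?_
    fin_cases i <;> fin_cases j <;>
      first
      | exact absurd hij (by decide)
      | assumption
      | exact hf ‹_›
      | exact hf (hf ‹_›)

end TraceZero

/-! ### The possible configurations of the two points. -/

section TraceZeroPairs

variable {F : Type*} [Field F] [Fintype F] {f : F[X]} {K : Type*} [Field K] [Algebra F K]

theorem isOddCurve [IsAlgClosure F K] (hchar : ringChar F ≠ 2) (hmonic : f.Monic)
    (hodd : Odd f.natDegree) (hsq : Squarefree f) : IsOddCurve f K := by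
  refine ⟨hmonic, hodd, PerfectField.separable_iff_squarefree.2 hsq, ?_⟩
  have h : algebraMap F K 2 ≠ 0 :=
    (map_ne_zero (algebraMap F K)).2 (Ring.two_ne_zero hchar)
  rwa [map_ofNat] at h

/-- If `P` is a conjugate of the rational point `Q`, then the trace of `P + Q - 2𝒪` is twice that
of `Q - 𝒪`, so it is not principal in the absence of `2`-torsion. -/
theorem trace_pairDiv_notMem [IsAlgClosed K] (H : IsOddCurve f K) (hdeg : 5 ≤ f.natDegree)
    (h2 : ¬ 2 ∣ Nat.card (picRat f K 3)) {P Q : Point f K} (hQ : Q ≠ .infinity)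
    (h : Q.frob.frob.frob = Q) (hPQ : P = Q ∨ P = Q.frob ∨ P = Q.frob.frob) :
    trace f K 3 (pairDiv P Q) ∉ principal f K := by
  have hr := single_sub_single_mem_ratDivZero h
  have h2T : trace f K 3 (pairDiv P Q) =
      2 • trace f K 3 (Finsupp.single Q 1 - Finsupp.single .infinity 1) := by
    have h3 := (mem_ratDivZero_three.1 hr).2
    rw [two_nsmul, pairDiv_eq, map_add]
    congr 1
    have hQ1 : (Finsupp.single Q.frob 1 - Finsupp.single .infinity 1 : Divisor f K) =
        frobDiv f K (Finsupp.single Q 1 - Finsupp.single .infinity 1) := by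
      rw [map_sub, frobDiv_single, frobDiv_single]
      rfl
    have hQ2 : (Finsupp.single Q.frob.frob 1 - Finsupp.single .infinity 1 : Divisor f K) =
        frobDiv f K (frobDiv f K (Finsupp.single Q 1 - Finsupp.single .infinity 1)) := by
      rw [← hQ1, map_sub, frobDiv_single, frobDiv_single]
      rfl
    rcases hPQ with rfl | rfl | rfl
    · rfl
    · rw [hQ1, trace_three_apply, trace_three_apply, h3]
      abel
    · rw [hQ2, trace_three_apply, trace_three_apply, h3]
      abel
  rw [h2T]
  exact fun hT => trace_single_sub_single_notMem H hdeg hQ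
    (mem_principal_of_smul_mem Nat.prime_two h2 (trace_three_mem_ratDivZero hr).2 hT)

theorem frobDiv_ne_self_of_trace (h3 : ¬ 3 ∣ Nat.card (picRat f K 3)) {D : Divisor f K}
    (hD : D ∈ ratDivZero f K 3) (hT : trace f K 3 D ∈ principal f K) (h0 : D ∉ principal f K) :
    frobDiv f K D ≠ D := by
  intro h
  refine h0 (mem_principal_of_smul_mem Nat.prime_three h3 hD ?_)
  rw [trace_three_apply, h, h] at hT
  rwa [succ_nsmul, two_nsmul]

theorem ne_of_configuration {P Q : Point f K} (h : ConfigI P Q ∨ ConfigII P Q ∨ ConfigIII P Q)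
    (hT : P.frob.frob.frob = P → P ≠ Q) : P ≠ Q := by
  rcases h with h | h | h
  · exact hT h.2.2.1
  · exact hT h.2.2.1
  · intro e
    exact h.2.1 (h.2.2.symm.trans e.symm)

theorem frob_three_of_mem_ratDivZero {P Q : Point f K} (h : pairDiv P Q ∈ ratDivZero f K 3) :
    (P.frob.frob.frob = P ∧ Q.frob.frob.frob = Q) ∨
      (P.frob.frob.frob = Q ∧ Q.frob.frob.frob = P) := by
  have := (mem_ratDivZero_three.1 h).2
  rw [frobDiv_pairDiv, frobDiv_pairDiv, frobDiv_pairDiv] at this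
  exact pairDiv_inj this

/-- If `φ³` fixes both points, they are rational and the trace forbids conjugate ones, leaving (i)
or (ii). If it swaps distinct points, they are conjugate over the sextic extension, which is (iii).
-/
theorem configuration_of_trace [IsAlgClosed K] (H : IsOddCurve f K) (hdeg : 5 ≤ f.natDegree)
    (h2 : ¬ 2 ∣ Nat.card (picRat f K 3)) {P Q : Point f K} (hP : P ≠ .infinity)
    (hQ : Q ≠ .infinity) (hD : pairDiv P Q ∈ ratDivZero f K 3)
    (hT : trace f K 3 (pairDiv P Q) ∈ principal f K) :
    ConfigI P Q ∨ ConfigII P Q ∨ ConfigIII P Q := by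
  rcases frob_three_of_mem_ratDivZero hD with ⟨hP3, hQ3⟩ | ⟨hPQ, hQP⟩
  · have hne : P ≠ Q ∧ P ≠ Q.frob ∧ P ≠ Q.frob.frob := by
      by_contra! hcon
      refine trace_pairDiv_notMem H hdeg h2 hQ hQ3 ?_ hT
      tauto
    by_cases hI : P = Q.frob.w ∨ P = Q.frob.frob.w
    · exact Or.inl ⟨hP, hQ, hP3, hQ3, hI⟩
    · rw [not_or] at hI
      exact Or.inr (Or.inl ⟨hP, hQ, hP3, hQ3, hne.1, hne.2.1, hne.2.2, hI.1, hI.2⟩)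
  · by_cases h : P = Q
    · subst h
      exact (trace_pairDiv_notMem H hdeg h2 hQ hPQ (Or.inl rfl) hT).elim
    · refine Or.inr (Or.inr ⟨?_, fun h3 => h (h3.symm.trans hPQ), hPQ.symm⟩)
      change P.frob.frob.frob.frob.frob.frob = P
      rw [hPQ, hQP]

variable [Algebra.IsAlgebraic F K]

/-- In the second and third configurations no point of `P + Q - 2𝒪` is opposite to the Frobenius
conjugate of a point of it. -/
theorem not_opposite_of_configuration [IsAlgClosed K] (H : IsOddCurve f K) (hdeg : 5 ≤ f.natDegree)
    (h2 : ¬ 2 ∣ Nat.card (picRat f K 3)) {P Q : Point f K} (hP : P ≠ .infinity)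
    (hQ : Q ≠ .infinity) (hPQ : P ≠ Q.w) (hfix : frobDiv f K (pairDiv P Q) ≠ pairDiv P Q)
    (h : ConfigII P Q ∨ ConfigIII P Q) :
    P ≠ P.frob.w ∧ Q ≠ Q.frob.w ∧ P ≠ Q.frob.w ∧ Q ≠ P.frob.w := by
  -- If `φ(R) = w(R)`, then `R = φ³(R) = w(R)`: a rational Weierstrass point, excluded by the
  -- absence of 2-torsion.
  have hrat {R : Point f K} (hR : R ≠ .infinity) (hR3 : R.frob.frob.frob = R) : R ≠ R.frob.w := by
    intro e
    have h1 : R.frob = R.w := Point.w_eq_iff.1 e.symm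
    refine Point.w_ne_self_of_rational H hdeg h2 hR hR3 ?_
    rw [h1, Point.frob_w, h1, Point.w_w, h1] at hR3
    exact hR3
  rcases h with ⟨-, -, hP3, hQ3, -, -, -, h4, h5⟩ | ⟨h6, h3, rfl⟩
  · refine ⟨hrat hP hP3, hrat hQ hQ3, h4, fun e => h5 ?_⟩
    rw [e, Point.frob_w, Point.frob_w, Point.w_w]
    exact hP3.symm
  · have h6 : P.frob.frob.frob.frob.frob.frob = P := h6
    have hPP : P ≠ P.frob.w := by
      intro e
      have h1 : P.frob = P.w := Point.w_eq_iff.1 e.symm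
      apply hPQ
      simp only [h1, Point.frob_w, Point.w_w]
    -- Here the second point `φ³(P)` equals `φ(P)`, so `φ` swaps the two points and fixes the
    -- divisor.
    have hpair (h1 : P.frob.frob = P) : False := by
      apply hfix
      rw [frobDiv_pairDiv, h1]
      simp only [h1, pairDiv]
      abel
    refine ⟨hPP, fun e => hPP ?_, fun e => ?_, fun e => ?_⟩
    · apply Point.frob_injective
      apply Point.frob_injective
      apply Point.frob_injective
      simpa only [Point.frob_w] using e
    -- From `φ⁴(P) = w(P)` and `φ⁶(P) = P` follows `φ²(P) = w(P)`, hence `φ⁴(P) = P`; so `w(P) = P`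
    -- and `φ²(P) = P`.
    · have h1 : P.frob.frob.frob.frob = P.w := Point.w_eq_iff.1 e.symm
      rw [h1, Point.frob_w, Point.frob_w] at h6
      have h7 : P.frob.frob = P.w := Point.w_eq_iff.1 h6
      rw [h7, Point.frob_w, Point.frob_w, h7, Point.w_w] at h1
      exact hpair (h7.trans h1.symm)
    · have h7 : P.frob.frob = P.w := by
        apply Point.frob_injective
        rw [e, Point.frob_w]
      have h8 : P.w = P := by
        rw [h7, Point.frob_w, Point.frob_w, h7, Point.w_w, h7] at h6
        exact h6
      exact hpair (h7.trans h8)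

end TraceZeroPairs

end OddHyperelliptic

/-! ### The main theorem. -/

open OddHyperelliptic in
theorem mainTheorem11 {F : Type*} [Field F] [Fintype F] (hchar : ringChar F ≠ 2)
    (K : Type*) [Field K] [Algebra F K] [IsAlgClosure F K]
    (f : F[X]) (hmonic : f.Monic) (hdeg : f.natDegree = 5) (hsq : Squarefree f)
    (h2 : ¬ 2 ∣ Nat.card (OddHyperelliptic.picRat f K 3))
    (h3 : ¬ 3 ∣ Nat.card (OddHyperelliptic.picRat f K 3))
    (c : OddHyperelliptic.ClassGroup f K) (hc : c ∈ OddHyperelliptic.traceZero f K 3)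
    (hc0 : c ≠ 0) :
    (∃ D : OddHyperelliptic.Divisor f K,
      OddHyperelliptic.IsReduced 2 D ∧ OddHyperelliptic.toClass f K D = c) ∧
    ∀ D : OddHyperelliptic.Divisor f K,
      OddHyperelliptic.IsReduced 2 D → OddHyperelliptic.toClass f K D = c →
      ∃ P₁ P₂ : OddHyperelliptic.Point f K,
        P₁ ≠ .infinity ∧ P₂ ≠ .infinity ∧ D = OddHyperelliptic.pairDiv P₁ P₂ ∧
        OddHyperelliptic.frobDiv f K D ≠ D ∧
        (OddHyperelliptic.ConfigI P₁ P₂ ∨ OddHyperelliptic.ConfigII P₁ P₂ ∨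
          OddHyperelliptic.ConfigIII P₁ P₂) ∧
        ¬ (OddHyperelliptic.ConfigI P₁ P₂ ∧ OddHyperelliptic.ConfigII P₁ P₂) ∧
        ¬ (OddHyperelliptic.ConfigI P₁ P₂ ∧ OddHyperelliptic.ConfigIII P₁ P₂) ∧
        ¬ (OddHyperelliptic.ConfigII P₁ P₂ ∧ OddHyperelliptic.ConfigIII P₁ P₂) ∧
        ∃ u v : K[X], OddHyperelliptic.IsMumford D u v ∧
          (∃ h₁ h₂ : F[X], OddHyperelliptic.IsDivOf (h₁.map (algebraMap F K))
            (h₂.map (algebraMap F K)) (OddHyperelliptic.trace f K 3 D)) ∧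
          (OddHyperelliptic.ConfigII P₁ P₂ ∨ OddHyperelliptic.ConfigIII P₁ P₂ →
            OddHyperelliptic.IsSemiReduced (D + OddHyperelliptic.frobDiv f K D) ∧
            ∀ h₁ h₂ : F[X], OddHyperelliptic.IsDivOf (h₁.map (algebraMap F K))
              (h₂.map (algebraMap F K)) (OddHyperelliptic.trace f K 3 D) →
              ¬ u ∣ h₂.map (algebraMap F K) ∧ h₂ ≠ 0) := by
  have : IsAlgClosed K := IsAlgClosure.isAlgClosed F
  have : Algebra.IsAlgebraic F K := IsAlgClosure.isAlgebraic
  have H : IsOddCurve f K := isOddCurve hchar hmonic (by rw [hdeg]; decide) hsq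
  have hdeg' : 5 ≤ f.natDegree := hdeg.ge
  obtain ⟨D₀, ⟨hD₀, hT₀⟩, rfl⟩ := hc
  refine ⟨exists_isReduced H hdeg (mem_ratDivZero_three.1 hD₀).1, fun D hred hcls => ?_⟩
  have hD : D ∈ ratDivZero f K 3 := hred.mem_ratDivZero H hdeg hD₀ hcls
  have hT : trace f K 3 D ∈ principal f K := by
    have := add_mem (trace_mem_principal (toClass_eq_iff.1 hcls)) hT₀
    rwa [map_sub, sub_add_cancel] at this
  have hD0 : D ∉ principal f K := by
    rw [← toClass_eq_zero, hcls]
    exact hc0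
  obtain ⟨r, hr, hsr⟩ := hred
  -- Weight 0 gives the zero class and weight 1 a trace of odd pole order 3; only weight 2 survives.
  interval_cases r
  · rw [isSemiReducedWith_zero] at hsr
    subst hsr
    exact (hD0 (zero_mem _)).elim
  · obtain ⟨P, hP, rfl⟩ := isSemiReducedWith_one.1 hsr
    exact (trace_single_sub_single_notMem H hdeg' hP hT).elim
  obtain ⟨P, Q, hP, hQ, hPQ, rfl⟩ := isSemiReducedWith_two.1 hsr
  have hfix := frobDiv_ne_self_of_trace h3 hD hT hD0
  have hconf := configuration_of_trace H hdeg' h2 hP hQ hD hT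
  have hne : P ≠ Q := ne_of_configuration hconf fun hP3 e => by
    subst e
    exact trace_pairDiv_notMem H hdeg' h2 hQ hP3 (Or.inl rfl) hT
  obtain ⟨u, v, huv, hu⟩ := exists_isMumford_pairDiv hP hQ hne hPQ
  refine ⟨P, Q, hP, hQ, rfl, hfix, hconf, ?_, fun h => h.2.2.1 h.1.2.2.1,
    fun h => h.2.2.1 h.1.2.2.1, u, v, huv, exists_isDivOf_trace H hdeg hP hQ hD hT, fun h => ?_⟩
  · rintro ⟨⟨-, -, -, -, h⟩, -, -, -, -, -, -, -, h4, h5⟩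
    exact h.elim h4 h5
  obtain ⟨hPP, hQQ, hPfQ, hQfP⟩ := not_opposite_of_configuration H hdeg' h2 hP hQ hPQ hfix h
  obtain ⟨hs4, hs6⟩ := isSemiReducedWith_trace hP hQ (frob_three_of_mem_ratDivZero hD) hPQ hPP hQQ
    hPfQ hQfP
  refine ⟨⟨4, hs4⟩, fun h₁ h₂ hdiv => ?_⟩
  have hh₂ : h₂ ≠ 0 := by
    rintro rfl
    rw [Polynomial.map_zero] at hdiv
    exact hs6.not_isDivOf_poly H (by decide) _ hdiv
  refine ⟨fun hdvd => ?_, hh₂⟩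
  -- The degree of `u` is 2, whereas `h₂` is a non-zero constant.
  have hle := natDegree_le_of_dvd hdvd ((Polynomial.map_ne_zero_iff (algebraMap F K).injective).2 hh₂)
  rw [hu, (natDegree_of_isDivOf_trace H hdeg hP hQ hdiv).2] at hle
  omega
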